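/- Let $n_r\ge n_t\ge 2$ and $\delta>0$. Let ${\bf H}$ be a random complex $n_r\times n_t$ matrix such that ${\bf H}^\dagger{\bf H}$ has the same distribution as ${\bf U}^\dagger\boldsymbol{\Lambda}{\bf U}$, where ${\bf U}$ is Haar-distributed on the unitary group $\mathcal U(n_t)$ and is independent of $\boldsymbol\Lambda=\mathrm{diag}(\lambda_1,\dots,\lambda_{n_t})$, whose entries are positive with joint density on $(0,\infty)^{n_t}$ $$p(\boldsymbol\Lambda)=\frac1{n_t!}\prod_{k>\ell}(\lambda_k-\lambda_\ell)\,\det[q_{b-1}(\lambda_a)]_{a,b=1,\dots,n_t}$$ for real functions $q_0,\dots,q_{n_t-1}$ on $(0,\infty)$. Let $p_0,\dots,p_{n_t-1}$ be monic real polynomials with $\deg p_j=j$ and $\int_0^\infty p_a(\lambda)q_b(\lambda)\,d\lambda=\delta_{ab}$ (Kronecker delta), where these integrals converge absolutely, and put $K(x,y)=\sum_{j=0}^{n_t-1}p_j(x)q_j(y)$. (That is, ${\bf H}$ is an invariant polynomial ensemble without transmit correlation, with kernel $K$; Pólya ensembles are a special case.) For $k=1,\dots,n_t$ let $$\gamma_k=\frac1{[({\bf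 I}+\delta{\bf H}^\dagger{\bf H})^{-1}]_{k,k}}-1$$ be the output SINR of the $k$-th stream at the MMSE receiver. Then each $\gamma_k$ has on $(0,\infty)$ the probability density $$\rho(\gamma)=\frac{n_t-1}{\delta}\left(\frac{\gamma}{\gamma+1}\right)^{n_t}\int_0^1(1-x)^{n_t-2}\left(x+\frac1\gamma\right)K\!\left(-\frac1\delta,\frac{\gamma x}{\delta}\right)dx ,$$ and the ergodic sum rate $R=\sum_{k=1}^{n_t}\mathbb E[\ln(1+\gamma_k)]$ is $$R=n_t\left[\int_0^\infty\ln(1+\delta x)\,K\!\left(-\frac1\delta,x\right)dx+\gamma_E+\Psi(n_t)\right],$$ where $\gamma_E$ is Euler's constant and $\Psi=\Gamma'/\Gamma$ is the digamma function. All expectations and integrals here converge absolutely. -/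

import Mathlib

open MeasureTheory
open scoped Matrix

/-! ### Complex matrices and the unitary group as measurable spaces -/

/-- The entrywise (equivalently, Borel) σ-algebra on complex matrices. -/
noncomputable instance Matrix.complexMeasurableSpace (m n : Type) : MeasurableSpace (Matrix m n ℂ) :=
  inferInstanceAs (MeasurableSpace (m → n → ℂ))

instance Matrix.complexBorelSpace (m n : Type) [Fintype m] [Fintype n] :
    BorelSpace (Matrix m n ℂ) :=
  inferInstanceAs (BorelSpace (m → n → ℂ))

noncomputable instance Matrix.unitaryGroupMeasurableSpace (n : ℕ) :
    MeasurableSpace (Matrix.unitaryGroup (Fin n) ℂ) :=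
  Subtype.instMeasurableSpace

instance Matrix.unitaryGroupBorelSpace (n : ℕ) :
    BorelSpace (Matrix.unitaryGroup (Fin n) ℂ) :=
  Subtype.borelSpace _

instance Matrix.unitaryGroupCompactSpace (n : ℕ) :
    CompactSpace (Matrix.unitaryGroup (Fin n) ℂ) := by
  have hc : IsClosed {A : Matrix (Fin n) (Fin n) ℂ | A ∈ Matrix.unitaryGroup (Fin n) ℂ} := by
    have h : {A : Matrix (Fin n) (Fin n) ℂ | A ∈ Matrix.unitaryGroup (Fin n) ℂ}
        = (fun A : Matrix (Fin n) (Fin n) ℂ => A * star A) ⁻¹' {1} := by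
      ext A
      simp [Matrix.mem_unitaryGroup_iff]
    rw [h]
    exact isClosed_singleton.preimage (continuous_id.mul continuous_star)
  have hK : IsCompact (Set.pi Set.univ fun _ : Fin n => Set.pi Set.univ fun _ : Fin n =>
      Metric.closedBall (0 : ℂ) 1) :=
    isCompact_univ_pi fun _ => isCompact_univ_pi fun _ => isCompact_closedBall 0 1
  refine isCompact_iff_compactSpace.mp (hK.of_isClosed_subset hc ?_)
  intro A hA i _ j _
  simpa using entry_norm_bound_of_unitary hA i j

/-- The Haar probability measure on the unitary group `U(n)` (the Haar measure normalised to give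
the whole compact group mass one). -/
noncomputable def unitaryHaar (n : ℕ) : Measure (Matrix.unitaryGroup (Fin n) ℂ) :=
  Measure.haarMeasure ⊤

/-! ### Invariant polynomial ensembles -/

/-- `p 0, …, p (n-1)` are monic real polynomials with `deg p_j = j` that are biorthonormal on
`(0, ∞)` to the weight functions `q 0, …, q (n-1)`, all the integrals being absolutely
convergent. -/
structure IsBiorthonormalSystem {n : ℕ} (p : Fin n → Polynomial ℝ) (q : Fin n → ℝ → ℝ) :
    Prop where
  monic : ∀ a, (p a).Monic
  natDegree_eq : ∀ a, (p a).natDegree = (a : ℕ)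
  integrable : ∀ a b, IntegrableOn (fun x => (p a).eval x * q b x) (Set.Ioi 0)
  biorthonormal : ∀ a b, ∫ x in Set.Ioi (0 : ℝ), (p a).eval x * q b x = if a = b then 1 else 0

/-- The joint eigenvalue density `(1/n!) Δ(Λ) det[q_{b-1}(λ_a)]` of a polynomial ensemble, with
`Δ(Λ) = ∏_{k > ℓ} (λ_k - λ_ℓ)`. -/
noncomputable def polynomialEnsembleDensity {n : ℕ} (q : Fin n → ℝ → ℝ) (l : Fin n → ℝ) : ℝ :=
  1 / (n.factorial : ℝ) * (∏ k : Fin n, ∏ j ∈ Finset.Iio k, (l k - l j)) *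
    (Matrix.of fun a b : Fin n => q b (l a)).det

/-- The kernel `K(x, y) = ∑_j p_j(x) q_j(y)`. -/
noncomputable def polynomialEnsembleKernel {n : ℕ} (p : Fin n → Polynomial ℝ)
    (q : Fin n → ℝ → ℝ) (x y : ℝ) : ℝ :=
  ∑ j : Fin n, (p j).eval x * q j y

/-- The random `nr × nt` matrix `H` is an invariant polynomial ensemble with weight functions `q`
and associated monic polynomials `p`: the random matrix `Hᴴ H` is distributed as `Uᴴ Λ U`, where
`U` is Haar-distributed on `U(nt)` and independent of the diagonal matrix `Λ`, whose entries are
positive and have the joint density `polynomialEnsembleDensity q`. -/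
structure IsInvariantPolynomialEnsemble {Ω : Type*} [MeasurableSpace Ω] (P : Measure Ω)
    {nr nt : ℕ} (H : Ω → Matrix (Fin nr) (Fin nt) ℂ)
    (p : Fin nt → Polynomial ℝ) (q : Fin nt → ℝ → ℝ) : Prop where
  aemeasurable : AEMeasurable H P
  system : IsBiorthonormalSystem p q
  density_nonneg : ∀ᵐ l ∂(volume.restrict (Set.univ.pi fun _ : Fin nt => Set.Ioi (0 : ℝ))),
    0 ≤ polynomialEnsembleDensity q l
  map_gram : P.map (fun ω => (H ω)ᴴ * H ω) =
    ((unitaryHaar nt).prod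
      ((volume.restrict (Set.univ.pi fun _ : Fin nt => Set.Ioi (0 : ℝ))).withDensity
        fun l => ENNReal.ofReal (polynomialEnsembleDensity q l))).map
      fun Ul : Matrix.unitaryGroup (Fin nt) ℂ × (Fin nt → ℝ) =>
        ((Ul.1 : Matrix (Fin nt) (Fin nt) ℂ))ᴴ * Matrix.diagonal (fun a => (Ul.2 a : ℂ)) *
          (Ul.1 : Matrix (Fin nt) (Fin nt) ℂ)

/-! ### The MMSE receiver -/

/-- The output SINR `1 / [(I + δ Hᴴ H)⁻¹]_{k,k} - 1` of the `k`-th stream at the MMSE receiver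
(the diagonal entries of the Hermitian matrix `(I + δ Hᴴ H)⁻¹` are real). -/
noncomputable def mmseSINR {nr nt : ℕ} (δ : ℝ) (H : Matrix (Fin nr) (Fin nt) ℂ) (k : Fin nt) : ℝ :=
  1 / ((1 + (δ : ℂ) • (Hᴴ * H) : Matrix (Fin nt) (Fin nt) ℂ)⁻¹ k k).re - 1

/-- The ergodic sum rate `∑_k 𝔼[ln(1 + γ_k)]` of the MMSE receiver, in nats. -/
noncomputable def mmseSumRate {Ω : Type*} [MeasurableSpace Ω] (P : Measure Ω) {nr nt : ℕ} (δ : ℝ)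
    (H : Ω → Matrix (Fin nr) (Fin nt) ℂ) : ℝ :=
  ∑ k : Fin nt, ∫ ω, Real.log (1 + mmseSINR δ (H ω) k) ∂P

/-! Write n for `nt` and X = 1/(1+γ) for the k-th diagonal entry of (I+δHᴴH)⁻¹. The law of γ is
found through the transform s ↦ E[(1+sX)^(-n)] = E[((1+γ)/(1+γ+s))^n]; the exponent n is what makes
every average below explicit.

Given Λ, unit columns of U yield 1+sX = ∑ (1+s/(1+δλ_a))|U_{a,k}|². A Gaussian integral computed in
two ways gives E_U[(∑ D_a|U_{a,k}|²)^(-n)] = ∏ 1/D_a (`integral_unitaryColumnForm`), so the Haar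
average is ∏ (1+δλ_a)/(1+δλ_a+s), which is ∏ (u-λ_a)/(v-λ_a) with u = -1/δ and v = -(1+s)/δ.

Lagrange interpolation turns this product times the eigenvalue density into a sum of determinants
with one row moved to u, and an Andréief argument (`integral_updateRow_det_mul_det`) gives the mean
∫ K(u,y) (u-y)/(v-y) dy (`integral_polynomialEnsembleLaw_prod`).

With c = δy, the integrand (1+c)/(1+c+s) is itself the transform of an explicit density κ_c
(`integral_sinrMixingKernel_mul_pow`). By Fubini the law of γ has the same transform as the signed
mixture ρ(g) = ∫ K(u,y) κ_{δy}(g) dy, and y = gx/δ recovers the stated formula. Derivatives of the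
transform at s = 0 give the moments of X in [0,1], so the transform determines the law, and ρ ≥ 0
follows.

For the rate, ∫ κ_c(g) ln(1+g) dg = ln(1+c) + H_{n-1} with H the harmonic numbers, while ∫ K(u,y) dy
= 1 and Ψ(n) = H_{n-1} - γ_E. -/

open Filter Topology Set

/-! ### Mixing densities and their integrals -/

/-- For every `c > 0` a probability density on `(c, ∞)`: the law of `(1 + c) / t - 1` for a
`Beta(1, n - 1)` variable `t`. -/
noncomputable def sinrMixingKernel (n : ℕ) (c g : ℝ) : ℝ :=
  (Ioi c).indicator (fun g => ((n : ℝ) - 1) * (1 + c) * (g - c) ^ (n - 2) / (1 + g) ^ n) g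

lemma sinrMixingKernel_nonneg {n : ℕ} (hn : 2 ≤ n) {c : ℝ} (hc : 0 < c) (g : ℝ) :
    0 ≤ sinrMixingKernel n c g := by
  refine indicator_nonneg (fun g (hg : c < g) => ?_) g
  have h1 : (2 : ℝ) ≤ n := by exact_mod_cast hn
  have h2 : 0 ≤ g - c := by linarith
  have h3 : 0 < 1 + g := by linarith
  have h4 : 0 ≤ (n : ℝ) - 1 := by linarith
  positivity

lemma measurable_sinrMixingKernel (n : ℕ) :
    Measurable fun z : ℝ × ℝ => sinrMixingKernel n z.1 z.2 := by
  have h : (fun z : ℝ × ℝ => sinrMixingKernel n z.1 z.2) =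
      {z : ℝ × ℝ | z.1 < z.2}.indicator
        fun z => ((n : ℝ) - 1) * (1 + z.1) * (z.2 - z.1) ^ (n - 2) / (1 + z.2) ^ n := by
    ext z
    simp [sinrMixingKernel, indicator_apply]
  rw [h]
  exact Measurable.indicator (by fun_prop) (measurableSet_lt measurable_fst measurable_snd)

/-- For d = 1 this is a primitive of the mixing density; for d = 1 + s, up to a constant factor, of
its product with the test function. -/
lemma hasDerivAt_div_add_pow {n : ℕ} (hn : 2 ≤ n) {c d g : ℝ} (hg : g + d ≠ 0) :
    HasDerivAt (fun g : ℝ => ((g - c) / (g + d)) ^ (n - 1))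
      (((n : ℝ) - 1) * (c + d) * (g - c) ^ (n - 2) / (g + d) ^ n) g := by
  obtain ⟨m, rfl⟩ := Nat.exists_eq_add_of_le' hn
  have h := ((((hasDerivAt_id g).sub_const c).div ((hasDerivAt_id g).add_const d) hg).pow (m + 1))
  refine h.congr_deriv ?_
  simp only [id, Pi.div_apply]
  push_cast
  rw [div_pow]
  field_simp
  ring

lemma tendsto_sub_div_add_atTop (c d : ℝ) :
    Tendsto (fun g : ℝ => (g - c) / (g + d)) atTop (𝓝 1) := by
  have h : Tendsto (fun g : ℝ => 1 - (c + d) * (g + d)⁻¹) atTop (𝓝 (1 - (c + d) * 0)) :=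
    ((tendsto_inv_atTop_zero.comp (tendsto_atTop_add_const_right _ d tendsto_id)).const_mul
      (c + d)).const_sub 1
  simp only [mul_zero, sub_zero] at h
  refine h.congr' ?_
  filter_upwards [eventually_gt_atTop (-d)] with g hg
  have : g + d ≠ 0 := by linarith
  field_simp
  ring

lemma indicator_Ioi_mul_integrableOn {c : ℝ} (hc : 0 < c) {φ : ℝ → ℝ} (h : IntegrableOn φ (Ioi c)) :
    IntegrableOn ((Ioi c).indicator φ) (Ioi 0) ∧
      ∫ g in Ioi (0 : ℝ), (Ioi c).indicator φ g = ∫ g in Ioi c, φ g := by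
  have hs : Ioi c ∩ Ioi (0 : ℝ) = Ioi c := inter_eq_left.2 (Ioi_subset_Ioi hc.le)
  refine ⟨?_, ?_⟩
  · rw [IntegrableOn, integrable_indicator_iff measurableSet_Ioi, IntegrableOn,
      Measure.restrict_restrict measurableSet_Ioi, hs]
    exact h
  · rw [integral_indicator measurableSet_Ioi, Measure.restrict_restrict measurableSet_Ioi, hs]

/-- The n-th power cancels the denominator (1+g)^n, leaving a multiple of the derivative of
((g-c)/(g+1+s))^(n-1), which runs from 0 at c to 1 at infinity. -/
lemma integral_sinrMixingKernel_mul_pow {n : ℕ} (hn : 2 ≤ n) {c s : ℝ} (hc : 0 < c) (hs : -1 < s) :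
    IntegrableOn (fun g => sinrMixingKernel n c g * ((1 + g) / (1 + g + s)) ^ n) (Ioi 0) ∧
      ∫ g in Ioi (0 : ℝ), sinrMixingKernel n c g * ((1 + g) / (1 + g + s)) ^ n =
        (1 + c) / (1 + c + s) := by
  have h1 : (2 : ℝ) ≤ n := by exact_mod_cast hn
  have h1' : (0 : ℝ) ≤ n - 1 := by linarith
  set φ : ℝ → ℝ := fun g =>
    (1 + c) / (c + (1 + s)) * (((n : ℝ) - 1) * (c + (1 + s)) * (g - c) ^ (n - 2) /
      (g + (1 + s)) ^ n) with hφ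
  have he : (fun g => sinrMixingKernel n c g * ((1 + g) / (1 + g + s)) ^ n) =
      (Ioi c).indicator φ := by
    ext g
    by_cases hg : c < g
    · have h2 : 0 < 1 + g := by linarith
      have h3 : 0 < 1 + g + s := by linarith
      have h4 : 0 < 1 + c + s := by linarith
      simp only [sinrMixingKernel, indicator_apply, mem_Ioi, hg, if_true, hφ]
      rw [show g + (1 + s) = 1 + g + s by ring, show c + (1 + s) = 1 + c + s by ring, div_pow]
      field_simp
    · simp [sinrMixingKernel, hg]
  have hd : ∀ g ∈ Ici c, HasDerivAt
      (fun g : ℝ => (1 + c) / (c + (1 + s)) * ((g - c) / (g + (1 + s))) ^ (n - 1)) (φ g) g := by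
    intro g hg
    have h3 : g + (1 + s) ≠ 0 := by have : c ≤ g := hg; linarith
    exact (hasDerivAt_div_add_pow hn h3).const_mul _
  have hnn : ∀ g ∈ Ioi c, 0 ≤ φ g := by
    intro g (hg : c < g)
    have h2 : 0 ≤ g - c := by linarith
    have h3 : 0 < g + (1 + s) := by linarith
    have h4 : 0 < c + (1 + s) := by linarith
    simp only [hφ]
    positivity
  have hl : Tendsto (fun g : ℝ => (1 + c) / (c + (1 + s)) *
      ((g - c) / (g + (1 + s))) ^ (n - 1)) atTop (𝓝 ((1 + c) / (c + (1 + s)) * 1 ^ (n - 1))) :=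
    ((tendsto_sub_div_add_atTop c (1 + s)).pow _).const_mul _
  have hi := integrableOn_Ioi_deriv_of_nonneg' hd hnn hl
  have hv := integral_Ioi_of_hasDerivAt_of_nonneg' hd hnn hl
  rw [he]
  refine ⟨(indicator_Ioi_mul_integrableOn hc hi).1, ?_⟩
  rw [(indicator_Ioi_mul_integrableOn hc hi).2, hv]
  have : n - 1 ≠ 0 := by omega
  simp only [one_pow, sub_self, zero_div, zero_pow this, mul_zero, sub_zero, mul_one]
  congr 1
  ring

/-- The factor 1 - r divides 1 - r^m, which reduces the limit to x log x → 0. -/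
lemma tendsto_mul_log_one_sub_pow (m : ℕ) :
    Tendsto (fun r : ℝ => (1 - r ^ m) * Real.log (1 - r)) (𝓝[<] 1) (𝓝 0) := by
  have h0 : Tendsto (fun r : ℝ => 1 - r) (𝓝[<] 1) (𝓝[>] 0) := by
    refine tendsto_nhdsWithin_iff.2 ⟨?_, ?_⟩
    · have : Tendsto (fun r : ℝ => 1 - r) (𝓝 1) (𝓝 (1 - 1)) := tendsto_id.const_sub 1
      rw [sub_self] at this
      exact this.mono_left nhdsWithin_le_nhds
    · filter_upwards [self_mem_nhdsWithin] with r hr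
      have : r < 1 := hr
      simpa using this
  have h1 : Tendsto (fun x : ℝ => Real.log x * x) (𝓝[>] 0) (𝓝 0) := by
    simpa using tendsto_log_mul_rpow_nhdsGT_zero (r := 1) one_pos
  have h2 : Tendsto (fun r : ℝ => ∑ j ∈ Finset.range m, r ^ j) (𝓝[<] 1)
      (𝓝 (∑ j ∈ Finset.range m, 1 ^ j)) :=
    (Continuous.tendsto (by fun_prop) _).mono_left nhdsWithin_le_nhds
  have h3 := (h1.comp h0).mul h2
  rw [zero_mul] at h3
  refine h3.congr fun r => ?_
  rw [← mul_neg_geom_sum r m]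
  simp only [Function.comp]
  ring

/-- `(1 - r^m) log (1 - r) + ∑_{j<m} r^(j+1)/(j+1)` is a primitive of `-m r^(m-1) log (1 - r)`. -/
lemma hasDerivAt_pow_mul_log_one_sub (m : ℕ) {r : ℝ} (hr : r < 1) :
    HasDerivAt (fun r : ℝ => (1 - r ^ m) * Real.log (1 - r) +
      ∑ j ∈ Finset.range m, r ^ (j + 1) / ((j : ℝ) + 1))
      (-(m * r ^ (m - 1) * Real.log (1 - r))) r := by
  have h1 : (1 - r) ≠ 0 := by linarith
  have hl : HasDerivAt (fun r : ℝ => Real.log (1 - r)) (-1 / (1 - r)) r :=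
    ((hasDerivAt_id r).const_sub 1).log h1
  have hp : HasDerivAt (fun r : ℝ => 1 - r ^ m) (-(m * r ^ (m - 1))) r :=
    (hasDerivAt_pow m r).const_sub 1
  have hs : HasDerivAt (fun r : ℝ => ∑ j ∈ Finset.range m, r ^ (j + 1) / ((j : ℝ) + 1))
      (∑ j ∈ Finset.range m, r ^ j) r := by
    refine HasDerivAt.fun_sum fun j _ => ?_
    refine ((hasDerivAt_pow (j + 1) r).div_const ((j : ℝ) + 1)).congr_deriv ?_
    have : (j : ℝ) + 1 ≠ 0 := by positivity
    simp only [Nat.add_sub_cancel]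
    push_cast
    field_simp
  refine ((hp.mul hl).add hs).congr_deriv ?_
  rw [← mul_neg_geom_sum r m]
  field_simp
  ring

/-- With r = (g-c)/(g+1) one has 1 - r = (1+c)/(1+g), hence log(1+g) = log(1+c) - log(1-r), while
the density is the derivative of r^(n-1). The boundary value of `Φ` at r = 1 is the harmonic number.
-/
lemma integral_sinrMixingKernel_mul_log {n : ℕ} (hn : 2 ≤ n) {c : ℝ} (hc : 0 < c) :
    IntegrableOn (fun g => sinrMixingKernel n c g * Real.log (1 + g)) (Ioi 0) ∧
      ∫ g in Ioi (0 : ℝ), sinrMixingKernel n c g * Real.log (1 + g) =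
        Real.log (1 + c) + (harmonic (n - 1) : ℝ) := by
  have h1 : (2 : ℝ) ≤ n := by exact_mod_cast hn
  have h1' : (0 : ℝ) ≤ n - 1 := by linarith
  set φ : ℝ → ℝ := fun g =>
    ((n : ℝ) - 1) * (c + 1) * (g - c) ^ (n - 2) / (g + 1) ^ n * Real.log (1 + g) with hφ
  have he : (fun g => sinrMixingKernel n c g * Real.log (1 + g)) = (Ioi c).indicator φ := by
    ext g
    by_cases hg : c < g
    · simp only [sinrMixingKernel, indicator_apply, mem_Ioi, hg, if_true, hφ]
      rw [add_comm g, add_comm c]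
    · simp [sinrMixingKernel, hg]
  set Φ : ℝ → ℝ := fun r => (1 - r ^ (n - 1)) * Real.log (1 - r) +
      ∑ j ∈ Finset.range (n - 1), r ^ (j + 1) / ((j : ℝ) + 1) with hΦ
  have hlt : ∀ g, c ≤ g → (g - c) / (g + 1) < 1 := by
    intro g hg
    rw [div_lt_one (by linarith)]
    linarith
  have hd : ∀ g ∈ Ici c, HasDerivAt (fun g : ℝ => Real.log (1 + c) *
      ((g - c) / (g + 1)) ^ (n - 1) + Φ ((g - c) / (g + 1))) (φ g) g := by
    intro g hg
    have hcg : c ≤ g := hg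
    have h3 : g + 1 ≠ 0 := by linarith
    have hr : HasDerivAt (fun g : ℝ => (g - c) / (g + 1)) ((c + 1) / (g + 1) ^ 2) g := by
      refine (((hasDerivAt_id g).sub_const c).div ((hasDerivAt_id g).add_const 1) h3).congr_deriv ?_
      simp only [id]
      congr 1
      ring
    have h5 := (hasDerivAt_pow_mul_log_one_sub (n - 1) (hlt g hcg)).comp g hr
    refine (((hasDerivAt_div_add_pow hn h3).const_mul (Real.log (1 + c))).add h5).congr_deriv ?_
    have h6 : 1 - (g - c) / (g + 1) = (1 + c) / (1 + g) := by
      have h7 : 1 + g ≠ 0 := by linarith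
      field_simp
      ring
    rw [h6, Real.log_div (by linarith) (by linarith)]
    obtain ⟨m, rfl⟩ := Nat.exists_eq_add_of_le' hn
    simp only [hφ, show m + 2 - 2 = m from rfl, show m + 2 - 1 = m + 1 from rfl,
      show m + 1 - 1 = m from rfl, div_pow]
    push_cast
    have h7 : 1 + g ≠ 0 := by linarith
    rw [add_comm g 1]
    field_simp
    ring
  have hnn : ∀ g ∈ Ioi c, 0 ≤ φ g := by
    intro g (hg : c < g)
    have h2 : 0 ≤ g - c := by linarith
    have h3 : 0 < g + 1 := by linarith
    have h4 : 0 ≤ Real.log (1 + g) := Real.log_nonneg (by linarith)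
    simp only [hφ]
    positivity
  have hΦl : Tendsto Φ (𝓝[<] 1) (𝓝 (0 + ∑ j ∈ Finset.range (n - 1), 1 ^ (j + 1) / ((j : ℝ) + 1))) :=
    (tendsto_mul_log_one_sub_pow _).add
      ((Continuous.tendsto (by fun_prop) _).mono_left nhdsWithin_le_nhds)
  have hr1 : Tendsto (fun g : ℝ => (g - c) / (g + 1)) atTop (𝓝[<] 1) := by
    refine tendsto_nhdsWithin_iff.2 ⟨tendsto_sub_div_add_atTop c 1, ?_⟩
    filter_upwards [eventually_ge_atTop c] with g hg using hlt g hg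
  have hl := (((tendsto_sub_div_add_atTop c 1).pow (n - 1)).const_mul (Real.log (1 + c))).add
    (hΦl.comp hr1)
  have hi := integrableOn_Ioi_deriv_of_nonneg' hd hnn hl
  have hv := integral_Ioi_of_hasDerivAt_of_nonneg' hd hnn hl
  rw [he]
  refine ⟨(indicator_Ioi_mul_integrableOn hc hi).1, ?_⟩
  rw [(indicator_Ioi_mul_integrableOn hc hi).2, hv]
  have : n - 1 ≠ 0 := by omega
  simp [hΦ, zero_pow this, harmonic]

/-- Fubini for a signed mixture of the densities `sinrMixingKernel n (δ * y)`. -/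
lemma integral_signed_mixture {n : ℕ} (hn : 2 ≤ n) {δ : ℝ} (hδ : 0 < δ) {w f F : ℝ → ℝ}
    (hw : AEStronglyMeasurable w (volume.restrict (Ioi 0))) (hf : Measurable f)
    (hf0 : ∀ g, 0 < g → 0 ≤ f g)
    (hfi : ∀ c, 0 < c → IntegrableOn (fun g => sinrMixingKernel n c g * f g) (Ioi 0))
    (hF : ∀ c, 0 < c → ∫ g in Ioi (0 : ℝ), sinrMixingKernel n c g * f g = F c)
    (hwF : IntegrableOn (fun y => w y * F (δ * y)) (Ioi 0)) :
    IntegrableOn (fun g => f g * ∫ y in Ioi (0 : ℝ), w y * sinrMixingKernel n (δ * y) g) (Ioi 0) ∧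
      ∫ g in Ioi (0 : ℝ), f g * (∫ y in Ioi (0 : ℝ), w y * sinrMixingKernel n (δ * y) g) =
        ∫ y in Ioi (0 : ℝ), w y * F (δ * y) := by
  set μ : Measure ℝ := volume.restrict (Ioi 0) with hμ
  set T : ℝ × ℝ → ℝ := fun z => w z.1 * (sinrMixingKernel n (δ * z.1) z.2 * f z.2) with hT
  have hk : Measurable fun z : ℝ × ℝ => sinrMixingKernel n (δ * z.1) z.2 :=
    (measurable_sinrMixingKernel n).comp (by fun_prop : Measurable fun z : ℝ × ℝ => (δ * z.1, z.2))
  have hTm : AEStronglyMeasurable T (μ.prod μ) :=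
    hw.comp_fst.mul (hk.mul (hf.comp measurable_snd)).aestronglyMeasurable
  have hpos : ∀ᵐ y ∂μ, 0 < y := ae_restrict_mem measurableSet_Ioi
  have hTi : Integrable T (μ.prod μ) := by
    rw [integrable_prod_iff hTm]
    refine ⟨?_, ?_⟩
    · filter_upwards [hpos] with y hy
      exact (hfi _ (mul_pos hδ hy)).const_mul (w y)
    · refine hwF.norm.congr ?_
      filter_upwards [hpos] with y hy
      have hδy := mul_pos hδ hy
      have h0 : 0 ≤ F (δ * y) := by
        rw [← hF _ hδy]
        exact setIntegral_nonneg measurableSet_Ioi fun g hg =>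
          mul_nonneg (sinrMixingKernel_nonneg hn hδy g) (hf0 g hg)
      rw [norm_mul, Real.norm_of_nonneg h0, ← hF _ hδy, ← integral_const_mul]
      refine setIntegral_congr_fun measurableSet_Ioi fun g hg => ?_
      simp only [hT]
      rw [norm_mul, Real.norm_of_nonneg
        (mul_nonneg (sinrMixingKernel_nonneg hn hδy g) (hf0 g hg))]
  have he : (fun g => f g * ∫ y in Ioi (0 : ℝ), w y * sinrMixingKernel n (δ * y) g) =
      fun g => ∫ y, T (y, g) ∂μ := by
    ext g
    rw [← integral_const_mul]
    refine integral_congr_ae (ae_of_all _ fun y => ?_)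
    simp only [hT]
    ring
  rw [he]
  refine ⟨hTi.integral_prod_right, ?_⟩
  rw [← integral_prod_symm T hTi, integral_prod T hTi]
  refine integral_congr_ae ?_
  filter_upwards [hpos] with y hy
  simp only [hT]
  rw [integral_const_mul, hF _ (mul_pos hδ hy)]

/-! ### Uniqueness: moments and generalised Stieltjes transforms -/

/-- Finite measures on `[0, 1]` are determined by their moments. -/
lemma Measure.ext_of_forall_integral_pow_eq {μ ν : Measure ℝ} [IsFiniteMeasure μ]
    [IsFiniteMeasure ν] (hμ : ∀ᵐ x ∂μ, x ∈ Icc (0 : ℝ) 1) (hν : ∀ᵐ x ∂ν, x ∈ Icc (0 : ℝ) 1)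
    (h : ∀ m : ℕ, ∫ x, x ^ m ∂μ = ∫ x, x ^ m ∂ν) : μ = ν := by
  have hpow : ∀ (κ : Measure ℝ) [IsFiniteMeasure κ], (∀ᵐ x ∂κ, x ∈ Icc (0 : ℝ) 1) → ∀ m : ℕ,
      Integrable (fun x : ℝ => x ^ m) κ := by
    intro κ _ hκ m
    refine Integrable.of_bound (by fun_prop) 1 ?_
    filter_upwards [hκ] with x hx
    rw [norm_pow, Real.norm_of_nonneg hx.1]
    exact pow_le_one₀ hx.1 hx.2
  have hev : ∀ (κ : Measure ℝ) [IsFiniteMeasure κ], (∀ᵐ x ∂κ, x ∈ Icc (0 : ℝ) 1) →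
      ∀ p : Polynomial ℝ, Integrable (fun x : ℝ => p.eval x) κ ∧
        ∫ x, p.eval x ∂κ = ∑ i ∈ Finset.range (p.natDegree + 1), p.coeff i * ∫ x, x ^ i ∂κ := by
    intro κ _ hκ p
    have he : (fun x : ℝ => p.eval x) =
        fun x => ∑ i ∈ Finset.range (p.natDegree + 1), p.coeff i * x ^ i := by
      ext x
      rw [Polynomial.eval_eq_sum_range]
    rw [he]
    refine ⟨integrable_finsetSum _ fun i _ => (hpow κ hκ i).const_mul _, ?_⟩
    rw [integral_finsetSum _ fun i _ => (hpow κ hκ i).const_mul _]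
    simp_rw [integral_const_mul]
  refine ext_of_forall_integral_eq_of_IsFiniteMeasure fun f => ?_
  have hb : ∀ ε : ℝ, 0 < ε →
      |∫ x, f x ∂μ - ∫ x, f x ∂ν| ≤ ε * (μ.real univ + ν.real univ) := by
    intro ε hε
    -- Weierstrass approximation on [0,1]; the two integrals of p agree by the moment hypothesis.
    obtain ⟨p, hp⟩ := exists_polynomial_near_of_continuousOn 0 1 f f.continuous.continuousOn ε hε
    have hpe : ∫ x, p.eval x ∂μ = ∫ x, p.eval x ∂ν := by
      rw [(hev μ hμ p).2, (hev ν hν p).2]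
      simp_rw [h]
    have key : ∀ (κ : Measure ℝ) [IsFiniteMeasure κ], (∀ᵐ x ∂κ, x ∈ Icc (0 : ℝ) 1) →
        |∫ x, p.eval x ∂κ - ∫ x, f x ∂κ| ≤ ε * κ.real univ := by
      intro κ _ hκ
      rw [← integral_sub (hev κ hκ p).1 (f.integrable κ), ← Real.norm_eq_abs]
      refine norm_integral_le_of_norm_le_const ?_
      filter_upwards [hκ] with x hx using (hp x hx).le
    have h1 := key μ hμ
    have h2 := key ν hν
    rw [← hpe] at h2
    rw [abs_le] at h1 h2 ⊢
    constructor <;> linarith [h1.1, h1.2, h2.1, h2.2]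
  have hlim : Tendsto (fun ε : ℝ => ε * (μ.real univ + ν.real univ)) (𝓝[>] 0) (𝓝 0) := by
    have : Tendsto (fun ε : ℝ => ε * (μ.real univ + ν.real univ)) (𝓝 0)
        (𝓝 (0 * (μ.real univ + ν.real univ))) := tendsto_id.mul_const _
    rw [zero_mul] at this
    exact this.mono_left nhdsWithin_le_nhds
  have := ge_of_tendsto hlim (eventually_mem_nhdsWithin.mono fun ε hε => hb ε hε)
  exact sub_eq_zero.1 (abs_nonpos_iff.1 this)

/-- Differentiation of the generalised Stieltjes transforms of a measure on `[0, 1]`. -/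
lemma hasDerivAt_integral_pow_div_pow {μ : Measure ℝ} [IsFiniteMeasure μ]
    (hμ : ∀ᵐ x ∂μ, x ∈ Icc (0 : ℝ) 1) (n m : ℕ) {s : ℝ} (hs : |s| < 1 / 2) :
    HasDerivAt (fun s => ∫ x, x ^ m / (1 + s * x) ^ (n + m) ∂μ)
      (-((n + m : ℕ) : ℝ) * ∫ x, x ^ (m + 1) / (1 + s * x) ^ (n + (m + 1)) ∂μ) s := by
  have hS : Ioo (-(1 / 2) : ℝ) (1 / 2) ∈ 𝓝 s := Ioo_mem_nhds (abs_lt.1 hs).1 (abs_lt.1 hs).2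
  -- For |t| < 1/2 the denominators stay above 1/2, which provides a constant dominating function.
  have hpos : ∀ x ∈ Icc (0 : ℝ) 1, ∀ t ∈ Ioo (-(1 / 2) : ℝ) (1 / 2), 1 / 2 ≤ 1 + t * x := by
    intro x hx t ht
    nlinarith [hx.1, hx.2, ht.1, ht.2]
  have hbd : ∀ x ∈ Icc (0 : ℝ) 1, ∀ t ∈ Ioo (-(1 / 2) : ℝ) (1 / 2), ∀ i j : ℕ,
      ‖x ^ i / (1 + t * x) ^ j‖ ≤ 2 ^ j := by
    intro x hx t ht i j
    have h1 := hpos x hx t ht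
    have h2 : (1 / 2 : ℝ) ^ j ≤ (1 + t * x) ^ j := pow_le_pow_left₀ (by norm_num) h1 j
    have h3 : 0 < (1 + t * x) ^ j := by positivity
    rw [norm_div, norm_pow, Real.norm_of_nonneg hx.1, Real.norm_of_nonneg h3.le, div_le_iff₀ h3]
    calc x ^ i ≤ 1 := pow_le_one₀ hx.1 hx.2
      _ = 2 ^ j * (1 / 2 : ℝ) ^ j := by rw [← mul_pow]; norm_num
      _ ≤ 2 ^ j * (1 + t * x) ^ j := by gcongr
  have hmeas : ∀ t : ℝ, ∀ i j : ℕ, AEStronglyMeasurable (fun x : ℝ => x ^ i / (1 + t * x) ^ j) μ :=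
    fun t i j => Measurable.aestronglyMeasurable (by fun_prop)
  have := (hasDerivAt_integral_of_dominated_loc_of_deriv_le (μ := μ)
    (F := fun t x => x ^ m / (1 + t * x) ^ (n + m))
    (F' := fun t x => -((n + m : ℕ) : ℝ) * (x ^ (m + 1) / (1 + t * x) ^ (n + (m + 1))))
    (bound := fun _ => ((n + m : ℕ) : ℝ) * 2 ^ (n + (m + 1))) hS
    (Eventually.of_forall fun t => hmeas t _ _)
    (Integrable.of_bound (hmeas s _ _) (2 ^ (n + m)) ?_)
    ((hmeas s _ _).const_mul _) ?_ (integrable_const _) ?_).2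
  · rwa [integral_const_mul] at this
  · filter_upwards [hμ] with x hx using hbd x hx s ⟨(abs_lt.1 hs).1, (abs_lt.1 hs).2⟩ _ _
  · filter_upwards [hμ] with x hx t ht
    rw [norm_mul, norm_neg, Real.norm_of_nonneg (by positivity)]
    gcongr
    exact hbd x hx t ht _ _
  · filter_upwards [hμ] with x hx t ht
    have h1 := hpos x hx t ht
    have h2 : 1 + t * x ≠ 0 := by linarith
    have hl : HasDerivAt (fun t : ℝ => 1 + t * x) x t := by
      simpa using ((hasDerivAt_id t).mul_const x).const_add 1
    refine ((hasDerivAt_const t (x ^ m)).div (hl.pow (n + m)) (pow_ne_zero _ h2)).congr_deriv ?_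
    simp only [Pi.pow_apply]
    rcases Nat.eq_zero_or_pos (n + m) with h0 | h0
    · simp [h0]
    · obtain ⟨k, hk⟩ := Nat.exists_eq_add_of_le' h0
      rw [show n + (m + 1) = k + 2 by omega, hk, show k + 1 - 1 = k from rfl]
      field_simp
      ring

/-- Each differentiation in s raises the power of x by one; at s = 0 the denominators are 1 and the
moments remain. Positivity of n keeps the factor n + m from vanishing at m = 0. -/
lemma Measure.ext_of_forall_integral_one_div_pow_eq {μ ν : Measure ℝ} [IsFiniteMeasure μ]
    [IsFiniteMeasure ν] (hμ : ∀ᵐ x ∂μ, x ∈ Icc (0 : ℝ) 1) (hν : ∀ᵐ x ∂ν, x ∈ Icc (0 : ℝ) 1)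
    {n : ℕ} (hn : 0 < n)
    (h : ∀ s : ℝ, |s| < 1 / 2 → ∫ x, 1 / (1 + s * x) ^ n ∂μ = ∫ x, 1 / (1 + s * x) ^ n ∂ν) :
    μ = ν := by
  have key : ∀ m : ℕ, ∀ s : ℝ, |s| < 1 / 2 →
      ∫ x, x ^ m / (1 + s * x) ^ (n + m) ∂μ = ∫ x, x ^ m / (1 + s * x) ^ (n + m) ∂ν := by
    intro m
    induction m with
    | zero => simpa using h
    | succ m ih =>
      intro s hs
      have h1 := hasDerivAt_integral_pow_div_pow hμ n m hs
      have h2 := hasDerivAt_integral_pow_div_pow hν n m hs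
      have he : (fun s => ∫ x, x ^ m / (1 + s * x) ^ (n + m) ∂μ) =ᶠ[𝓝 s]
          fun s => ∫ x, x ^ m / (1 + s * x) ^ (n + m) ∂ν := by
        filter_upwards [(isOpen_lt continuous_abs continuous_const).mem_nhds hs] with t ht
          using ih t ht
      have h3 := h1.unique (h2.congr_of_eventuallyEq he)
      have h4 : -((n + m : ℕ) : ℝ) ≠ 0 := by
        rw [neg_ne_zero, Nat.cast_ne_zero]
        omega
      exact mul_left_cancel₀ h4 h3
  refine Measure.ext_of_forall_integral_pow_eq hμ hν fun m => ?_
  simpa using key m 0 (by norm_num)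

/-- Finite measures on `(0, ∞)` are determined by the integrals of `((1 + g) / (1 + g + s)) ^ n`
for small `s`. -/
lemma Measure.ext_of_forall_integral_div_pow_eq {μ ν : Measure ℝ} [IsFiniteMeasure μ]
    [IsFiniteMeasure ν] (hμ : ∀ᵐ g ∂μ, 0 < g) (hν : ∀ᵐ g ∂ν, 0 < g) {n : ℕ} (hn : 0 < n)
    (h : ∀ s : ℝ, |s| < 1 / 2 →
      ∫ g, ((1 + g) / (1 + g + s)) ^ n ∂μ = ∫ g, ((1 + g) / (1 + g + s)) ^ n ∂ν) :
    μ = ν := by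
  -- The map g ↦ 1/(1+g) sends (0,∞) into [0,1], is inverted there by `ψ`, and turns (1+g)/(1+g+s)
  -- into 1/(1+sx).
  set φ : ℝ → ℝ := fun g => 1 / (1 + g) with hφ
  set ψ : ℝ → ℝ := fun x => 1 / x - 1 with hψ
  have hφm : Measurable φ := by fun_prop
  have hψm : Measurable ψ := by fun_prop
  have hmem : ∀ κ : Measure ℝ, (∀ᵐ g ∂κ, 0 < g) → ∀ᵐ x ∂κ.map φ, x ∈ Icc (0 : ℝ) 1 := by
    intro κ hκ
    rw [ae_map_iff (p := fun x => x ∈ Icc (0 : ℝ) 1) hφm.aemeasurable measurableSet_Icc]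
    filter_upwards [hκ] with g hg
    refine ⟨by positivity, ?_⟩
    rw [hφ, div_le_one (by positivity)]
    linarith
  have hback : ∀ κ : Measure ℝ, (∀ᵐ g ∂κ, 0 < g) → (κ.map φ).map ψ = κ := by
    intro κ hκ
    rw [Measure.map_map hψm hφm]
    conv_rhs => rw [← Measure.map_id (μ := κ)]
    refine Measure.map_congr ?_
    filter_upwards [hκ] with g hg
    simp [hφ, hψ]
  have hint : ∀ κ : Measure ℝ, (∀ᵐ g ∂κ, 0 < g) → ∀ s : ℝ, |s| < 1 / 2 →
      ∫ x, 1 / (1 + s * x) ^ n ∂κ.map φ = ∫ g, ((1 + g) / (1 + g + s)) ^ n ∂κ := by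
    intro κ hκ s hs
    rw [integral_map hφm.aemeasurable (Measurable.aestronglyMeasurable (by fun_prop))]
    refine integral_congr_ae ?_
    filter_upwards [hκ] with g hg
    have h1 : 0 < 1 + g + s := by linarith [(abs_lt.1 hs).1]
    simp only [hφ]
    rw [← one_div_pow]
    congr 1
    field_simp
  rw [← hback μ hμ, ← hback ν hν]
  congr 1
  refine Measure.ext_of_forall_integral_one_div_pow_eq (hmem μ hμ) (hmem ν hν) hn fun s hs => ?_
  rw [hint μ hμ s hs, hint ν hν s hs, h s hs]

/-! ### Haar averages over the unitary group -/

section UnitaryHaar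

variable {n : ℕ}

instance : (unitaryHaar n).IsHaarMeasure := by
  unfold unitaryHaar; infer_instance

instance : IsProbabilityMeasure (unitaryHaar n) :=
  ⟨by unfold unitaryHaar; exact Measure.haarMeasure_self⟩

/-- A right translate of Haar measure is again a Haar probability measure, and that is unique. -/
lemma unitaryHaar_map_mul_right (V : Matrix.unitaryGroup (Fin n) ℂ) :
    (unitaryHaar n).map (· * V) = unitaryHaar n := by
  have : IsProbabilityMeasure ((unitaryHaar n).map (· * V)) :=
    Measure.isProbabilityMeasure_map (by fun_prop)
  exact Measure.isHaarMeasure_eq_of_isProbabilityMeasure _ _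

lemma Matrix.exists_unitary_mulVec_single_eq (z : Fin n → ℂ) (k : Fin n) :
    ∃ V : Matrix.unitaryGroup (Fin n) ℂ,
      z = (V : Matrix (Fin n) (Fin n) ℂ) *ᵥ Pi.single k ((√(∑ a, ‖z a‖ ^ 2) : ℝ) : ℂ) := by
  set r : ℝ := √(∑ a, ‖z a‖ ^ 2) with hr
  by_cases h0 : r = 0
  · refine ⟨1, ?_⟩
    have h1 : ∑ a, ‖z a‖ ^ 2 = 0 :=
      (Real.sqrt_eq_zero (Finset.sum_nonneg fun _ _ => by positivity)).1 h0
    rw [Finset.sum_eq_zero_iff_of_nonneg (fun _ _ => by positivity)] at h1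
    ext a
    have := h1 a (Finset.mem_univ a)
    simpa [h0] using this
  · set e : EuclideanSpace ℂ (Fin n) := WithLp.toLp 2 z with he
    have hne : ‖e‖ = r := by rw [EuclideanSpace.norm_eq]
    -- A one-vector family indexed by {k}: extending it to an orthonormal basis places z/r in column
    -- k of the unitary matrix.
    have hv : Orthonormal ℂ (({k} : Set (Fin n)).domRestrict
        fun _ : Fin n => ((r : ℂ)⁻¹ • e : EuclideanSpace ℂ (Fin n))) := by
      refine ⟨fun i => ?_, fun i j hij => absurd (Subsingleton.elim i j) hij⟩
      have : 0 ≤ r := Real.sqrt_nonneg _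
      simp [Set.domRestrict_apply, norm_smul, hne, abs_of_nonneg this, h0]
    obtain ⟨b, hb⟩ := hv.exists_orthonormalBasis_extension_of_card_eq (by simp)
    refine ⟨⟨_, (EuclideanSpace.basisFun (Fin n) ℂ).toMatrix_orthonormalBasis_mem_unitary b⟩, ?_⟩
    ext a
    have := congrArg (fun v : EuclideanSpace ℂ (Fin n) => v a) (hb k rfl)
    simp only [PiLp.smul_apply, smul_eq_mul, he] at this
    have hr0 : (r : ℂ) ≠ 0 := by exact_mod_cast h0
    simp [Module.Basis.toMatrix_apply, this]
    field_simp

/-- The quadratic form `∑_a D_a |z_a|²`. -/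
noncomputable def diagonalForm (D : Fin n → ℝ) (z : Fin n → ℂ) : ℝ := ∑ a, D a * ‖z a‖ ^ 2

lemma continuous_diagonalForm (D : Fin n → ℝ) : Continuous (diagonalForm D) := by
  unfold diagonalForm; fun_prop

lemma integral_exp_neg_mul_norm_sq {b : ℝ} (hb : 0 < b) :
    Integrable (fun z : ℂ => Real.exp (-(b * ‖z‖ ^ 2))) ∧
      ∫ z : ℂ, Real.exp (-(b * ‖z‖ ^ 2)) = Real.pi / b := by
  have h := GaussianFourier.integral_rexp_neg_mul_sq_norm (V := ℂ) hb
  rw [Complex.finrank_real_complex] at h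
  norm_num at h
  refine ⟨?_, h⟩
  -- A non-integrable function would have integral 0 by convention, contradicting the positive
  -- value.
  by_contra hc
  rw [integral_undef hc] at h
  have : 0 < Real.pi / b := by positivity
  linarith

lemma lintegral_exp_neg_diagonalForm {D : Fin n → ℝ} (hD : ∀ a, 0 < D a) :
    ∫⁻ z : Fin n → ℂ, ENNReal.ofReal (Real.exp (-diagonalForm D z)) =
      ENNReal.ofReal (∏ a, Real.pi / D a) := by
  have he : ∀ z : Fin n → ℂ, Real.exp (-diagonalForm D z) =
      ∏ a, Real.exp (-(D a * ‖z a‖ ^ 2)) := by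
    intro z
    rw [← Real.exp_sum, Finset.sum_neg_distrib, diagonalForm]
  simp_rw [he]
  rw [volume_pi, ← ofReal_integral_eq_lintegral_ofReal
      (Integrable.fintype_prod (f := fun a (z : ℂ) => Real.exp (-(D a * ‖z‖ ^ 2)))
        fun a => (integral_exp_neg_mul_norm_sq (hD a)).1)
      (ae_of_all _ fun z => Finset.prod_nonneg fun a _ => (Real.exp_pos _).le),
    integral_fintype_prod_eq_prod (f := fun a (z : ℂ) => Real.exp (-(D a * ‖z‖ ^ 2)))]
  simp_rw [(integral_exp_neg_mul_norm_sq (hD _)).2]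

lemma Matrix.det_restrictScalars_toLin' (M : Matrix (Fin n) (Fin n) ℂ) :
    LinearMap.det ((Matrix.toLin' M).restrictScalars ℝ) = ‖M.det‖ ^ 2 := by
  have h := LinearMap.det_restrictScalars (R := ℝ) (f := Matrix.toLin' M)
  rw [h, LinearMap.det_toLin', Algebra.norm_complex_apply, Complex.normSq_eq_norm_sq]

lemma Matrix.norm_det_unitary_sq (U : Matrix.unitaryGroup (Fin n) ℂ) :
    ‖(U : Matrix (Fin n) (Fin n) ℂ).det‖ ^ 2 = 1 := by
  have h := congrArg (fun M : Matrix (Fin n) (Fin n) ℂ => ‖M.det‖)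
    (Matrix.mem_unitaryGroup_iff.1 U.2)
  simp only [Matrix.det_mul, norm_mul, Matrix.star_eq_conjTranspose, Matrix.det_conjTranspose,
    norm_star, Matrix.det_one, norm_one] at h
  rw [sq, h]

lemma map_volume_of_det_eq_one (L : (Fin n → ℂ) →ₗ[ℝ] (Fin n → ℂ)) (h : LinearMap.det L = 1) :
    (volume : Measure (Fin n → ℂ)).map L = volume := by
  rw [Measure.map_linearMap_addHaar_eq_smul_addHaar (volume : Measure (Fin n → ℂ))
    (by rw [h]; exact one_ne_zero), h]
  simp

lemma unitary_map_volume (U : Matrix.unitaryGroup (Fin n) ℂ) :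
    (volume : Measure (Fin n → ℂ)).map (fun z => (U : Matrix (Fin n) (Fin n) ℂ) *ᵥ z) = volume := by
  have hdet := Matrix.det_restrictScalars_toLin' (U : Matrix (Fin n) (Fin n) ℂ)
  rw [Matrix.norm_det_unitary_sq] at hdet
  exact map_volume_of_det_eq_one _ hdet

lemma Matrix.measurable_unitary_mulVec :
    Measurable fun x : Matrix.unitaryGroup (Fin n) ℂ × (Fin n → ℂ) =>
      (x.1 : Matrix (Fin n) (Fin n) ℂ) *ᵥ x.2 := by
  refine Continuous.measurable ?_
  fun_prop

/-- `∑_a D_a |U_{a,k}|²`, the `k`-th diagonal entry of `Uᴴ D U`. -/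
noncomputable def unitaryColumnForm (D : Fin n → ℝ) (k : Fin n)
    (U : Matrix.unitaryGroup (Fin n) ℂ) : ℝ :=
  ∑ a, D a * ‖(U : Matrix (Fin n) (Fin n) ℂ) a k‖ ^ 2

lemma sum_norm_sq_unitary_col (U : Matrix.unitaryGroup (Fin n) ℂ) (k : Fin n) :
    ∑ a, ‖(U : Matrix (Fin n) (Fin n) ℂ) a k‖ ^ 2 = 1 := by
  have h := congrFun (congrFun (Matrix.mem_unitaryGroup_iff'.1 U.2) k) k
  rw [Matrix.mul_apply] at h
  simp only [Matrix.star_apply, Matrix.one_apply_eq] at h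
  have h2 : ∀ a, star ((U : Matrix (Fin n) (Fin n) ℂ) a k) * (U : Matrix (Fin n) (Fin n) ℂ) a k =
      ((‖(U : Matrix (Fin n) (Fin n) ℂ) a k‖ ^ 2 : ℝ) : ℂ) := by
    intro a
    rw [← starRingEnd_apply, Complex.conj_mul']
    push_cast
    rfl
  simp_rw [h2] at h
  exact_mod_cast h

lemma unitaryColumnForm_pos {D : Fin n → ℝ} (hD : ∀ a, 0 < D a) (k : Fin n)
    (U : Matrix.unitaryGroup (Fin n) ℂ) : 0 < unitaryColumnForm D k U := by
  refine (Finset.sum_nonneg fun a _ => mul_nonneg (hD a).le (by positivity)).lt_of_ne' fun h => ?_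
  rw [Finset.sum_eq_zero_iff_of_nonneg fun a _ => mul_nonneg (hD a).le (by positivity)] at h
  have h1 := sum_norm_sq_unitary_col U k
  rw [Finset.sum_eq_zero fun a ha => (mul_eq_zero.1 (h a ha)).resolve_left (hD a).ne'] at h1
  exact zero_ne_one h1

lemma continuous_unitaryColumnForm (D : Fin n → ℝ) (k : Fin n) :
    Continuous (unitaryColumnForm D k) := by
  unfold unitaryColumnForm
  have h : Continuous fun U : Matrix.unitaryGroup (Fin n) ℂ => (U : Matrix (Fin n) (Fin n) ℂ) :=
    continuous_subtype_val
  exact continuous_finsetSum _ fun a _ => continuous_const.mul ((h.matrix_elem a k).norm.pow 2)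

/-- By right invariance, only the length of `z` matters for the average over the unitary group. -/
lemma lintegral_unitaryHaar_mulVec (D : Fin n → ℝ) (k : Fin n) (z : Fin n → ℂ) :
    ∫⁻ U, ENNReal.ofReal (Real.exp (-diagonalForm D
        ((U : Matrix (Fin n) (Fin n) ℂ) *ᵥ z))) ∂unitaryHaar n =
      ∫⁻ U, ENNReal.ofReal (Real.exp (-diagonalForm (fun _ => unitaryColumnForm D k U) z))
        ∂unitaryHaar n := by
  obtain ⟨V, hV⟩ := Matrix.exists_unitary_mulVec_single_eq z k
  set r : ℝ := √(∑ a, ‖z a‖ ^ 2) with hr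
  have hr2 : r ^ 2 = ∑ a, ‖z a‖ ^ 2 := Real.sq_sqrt (Finset.sum_nonneg fun _ _ => by positivity)
  set g : Matrix.unitaryGroup (Fin n) ℂ → ENNReal := fun U =>
    ENNReal.ofReal (Real.exp (-diagonalForm D
      ((U : Matrix (Fin n) (Fin n) ℂ) *ᵥ Pi.single k (r : ℂ)))) with hg
  have hgm : Measurable g := by
    refine ENNReal.measurable_ofReal.comp (Real.measurable_exp.comp (Measurable.neg ?_))
    exact (continuous_diagonalForm D).measurable.comp
      (Matrix.measurable_unitary_mulVec.comp (measurable_id.prodMk measurable_const))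
  calc _ = ∫⁻ U, g (U * V) ∂unitaryHaar n := by
        refine lintegral_congr fun U => ?_
        simp only [hg]
        conv_lhs => rw [hV]
        rw [Matrix.mulVec_mulVec]
        rfl
    _ = ∫⁻ U, g U ∂unitaryHaar n := by
        rw [← lintegral_map hgm (by fun_prop), unitaryHaar_map_mul_right]
    _ = _ := by
        refine lintegral_congr fun U => ?_
        simp only [hg]
        congr 3
        unfold diagonalForm
        rw [← Finset.mul_sum, ← hr2, unitaryColumnForm, Finset.sum_mul]
        refine Finset.sum_congr rfl fun a _ => ?_
        simp [Matrix.mulVec_single, mul_pow, mul_assoc]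

/-- The Gaussian exp(-∑ D_a|(Uz)_a|²) is integrated over U and z in both orders. Unitary invariance
of Lebesgue measure gives ∏ π/D_a for every U. Averaging over U first allows z to be replaced by
|z|e_k, after which the z-integral is π^n divided by the n-th power of the column form. -/
lemma lintegral_unitaryColumnForm {D : Fin n → ℝ} (hD : ∀ a, 0 < D a) (k : Fin n) :
    ∫⁻ U, ENNReal.ofReal ((unitaryColumnForm D k U ^ n)⁻¹) ∂unitaryHaar n =
      ENNReal.ofReal (∏ a, (D a)⁻¹) := by
  have hm : Measurable fun x : Matrix.unitaryGroup (Fin n) ℂ × (Fin n → ℂ) =>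
      ENNReal.ofReal (Real.exp (-diagonalForm D ((x.1 : Matrix (Fin n) (Fin n) ℂ) *ᵥ x.2))) :=
    ENNReal.measurable_ofReal.comp (Real.measurable_exp.comp
      ((continuous_diagonalForm D).measurable.comp Matrix.measurable_unitary_mulVec).neg)
  have hm2 : Measurable fun x : Matrix.unitaryGroup (Fin n) ℂ × (Fin n → ℂ) =>
      ENNReal.ofReal (Real.exp (-diagonalForm (fun _ => unitaryColumnForm D k x.1) x.2)) := by
    refine ENNReal.measurable_ofReal.comp (Real.measurable_exp.comp (Measurable.neg ?_))
    unfold diagonalForm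
    have := (continuous_unitaryColumnForm D k).measurable
    fun_prop
  have h1 : ∫⁻ U, ∫⁻ z : Fin n → ℂ, ENNReal.ofReal (Real.exp (-diagonalForm D
        ((U : Matrix (Fin n) (Fin n) ℂ) *ᵥ z))) ∂volume ∂unitaryHaar n =
      ENNReal.ofReal (∏ a, Real.pi / D a) := by
    have : ∀ U : Matrix.unitaryGroup (Fin n) ℂ, ∫⁻ z : Fin n → ℂ,
        ENNReal.ofReal (Real.exp (-diagonalForm D ((U : Matrix (Fin n) (Fin n) ℂ) *ᵥ z))) =
          ENNReal.ofReal (∏ a, Real.pi / D a) := by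
      intro U
      rw [← lintegral_exp_neg_diagonalForm hD, ← lintegral_map
        (f := fun z => ENNReal.ofReal (Real.exp (-diagonalForm D z)))
        (g := fun z => (U : Matrix (Fin n) (Fin n) ℂ) *ᵥ z), unitary_map_volume]
      · exact ENNReal.measurable_ofReal.comp (Real.measurable_exp.comp
          (continuous_diagonalForm D).measurable.neg)
      · exact Matrix.measurable_unitary_mulVec.comp (measurable_const.prodMk measurable_id)
    simp_rw [this]
    simp
  have h2 : ∫⁻ U, ∫⁻ z : Fin n → ℂ, ENNReal.ofReal (Real.exp (-diagonalForm D
        ((U : Matrix (Fin n) (Fin n) ℂ) *ᵥ z))) ∂volume ∂unitaryHaar n =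
      ∫⁻ U, ENNReal.ofReal (Real.pi ^ n) * ENNReal.ofReal ((unitaryColumnForm D k U ^ n)⁻¹)
        ∂unitaryHaar n := by
    rw [lintegral_lintegral_swap hm.aemeasurable]
    simp_rw [lintegral_unitaryHaar_mulVec D k]
    rw [← lintegral_lintegral_swap hm2.aemeasurable]
    refine lintegral_congr fun U => ?_
    rw [lintegral_exp_neg_diagonalForm fun _ => unitaryColumnForm_pos hD k U,
      ← ENNReal.ofReal_mul (by positivity)]
    simp [div_eq_mul_inv, mul_pow]
  rw [h1, lintegral_const_mul' _ _ ENNReal.ofReal_ne_top] at h2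
  have h3 : (∏ a, Real.pi / D a) = Real.pi ^ n * ∏ a, (D a)⁻¹ := by
    simp [div_eq_mul_inv, Finset.prod_mul_distrib]
  rw [h3, ENNReal.ofReal_mul (by positivity)] at h2
  exact ((ENNReal.mul_right_inj (by positivity) ENNReal.ofReal_ne_top).1 h2).symm

/-- Feynman parametrisation over the unitary group. -/
theorem integral_unitaryColumnForm {D : Fin n → ℝ} (hD : ∀ a, 0 < D a) (k : Fin n) :
    ∫ U, (unitaryColumnForm D k U ^ n)⁻¹ ∂unitaryHaar n = ∏ a, (D a)⁻¹ := by
  rw [integral_eq_lintegral_of_nonneg_ae, lintegral_unitaryColumnForm hD, ENNReal.toReal_ofReal]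
  · exact Finset.prod_nonneg fun a _ => (inv_pos.2 (hD a)).le
  · exact ae_of_all _ fun U => inv_nonneg.2 (pow_nonneg (unitaryColumnForm_pos hD k U).le _)
  · exact (((continuous_unitaryColumnForm D k).pow n).measurable.inv).aestronglyMeasurable

/-- The Gram matrix `Uᴴ Λ U`. -/
noncomputable def unitaryConjDiagonal (U : Matrix.unitaryGroup (Fin n) ℂ) (l : Fin n → ℝ) :
    Matrix (Fin n) (Fin n) ℂ :=
  ((U : Matrix (Fin n) (Fin n) ℂ))ᴴ * Matrix.diagonal (fun a => (l a : ℂ)) *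
    (U : Matrix (Fin n) (Fin n) ℂ)

lemma inv_one_add_smul_unitaryConjDiagonal {δ : ℝ} (hδ : 0 < δ) {l : Fin n → ℝ}
    (hl : ∀ a, 0 < l a) (U : Matrix.unitaryGroup (Fin n) ℂ) :
    (1 + (δ : ℂ) • unitaryConjDiagonal U l)⁻¹ =
      unitaryConjDiagonal U fun a => (1 + δ * l a)⁻¹ := by
  have hU1 : (U : Matrix (Fin n) (Fin n) ℂ)ᴴ * (U : Matrix (Fin n) (Fin n) ℂ) = 1 :=
    Matrix.mem_unitaryGroup_iff'.1 U.2
  have hU2 : (U : Matrix (Fin n) (Fin n) ℂ) * (U : Matrix (Fin n) (Fin n) ℂ)ᴴ = 1 :=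
    Matrix.mem_unitaryGroup_iff.1 U.2
  set W := (U : Matrix (Fin n) (Fin n) ℂ) with hW
  have h1 : 1 + (δ : ℂ) • unitaryConjDiagonal U l =
      Wᴴ * Matrix.diagonal (fun a => 1 + (δ : ℂ) * (l a : ℂ)) * W := by
    have : Matrix.diagonal (fun a => 1 + (δ : ℂ) * (l a : ℂ)) =
        1 + (δ : ℂ) • Matrix.diagonal (fun a => (l a : ℂ)) := by
      rw [← Matrix.diagonal_one, ← Matrix.diagonal_smul, Matrix.diagonal_add]
      rfl
    rw [this, unitaryConjDiagonal, mul_add, add_mul, mul_one, hU1]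
    simp [hW]
  refine Matrix.inv_eq_right_inv ?_
  rw [h1, unitaryConjDiagonal, ← hW]
  calc _ = Wᴴ * (Matrix.diagonal (fun a => 1 + (δ : ℂ) * (l a : ℂ)) * (W * Wᴴ) *
        Matrix.diagonal (fun a => (((1 + δ * l a)⁻¹ : ℝ) : ℂ))) * W := by
        simp only [mul_assoc]
    _ = 1 := by
        rw [hU2, mul_one, Matrix.diagonal_mul_diagonal]
        have : (fun a => (1 + (δ : ℂ) * (l a : ℂ)) * (((1 + δ * l a)⁻¹ : ℝ) : ℂ)) = fun _ => 1 := by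
          ext a
          have h : (1 + δ * l a) ≠ 0 := by have := mul_pos hδ (hl a); linarith
          rw [show (1 + (δ : ℂ) * (l a : ℂ)) = ((1 + δ * l a : ℝ) : ℂ) by push_cast; rfl,
            ← Complex.ofReal_mul, mul_inv_cancel₀ h, Complex.ofReal_one]
        rw [this, Matrix.diagonal_one, mul_one, hU1]

lemma unitaryConjDiagonal_apply_self (U : Matrix.unitaryGroup (Fin n) ℂ) (l : Fin n → ℝ)
    (k : Fin n) : (unitaryConjDiagonal U l k k).re = unitaryColumnForm l k U := by
  have : unitaryConjDiagonal U l k k = ((unitaryColumnForm l k U : ℝ) : ℂ) := by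
    rw [unitaryConjDiagonal, Matrix.mul_apply, unitaryColumnForm]
    push_cast
    refine Finset.sum_congr rfl fun a _ => ?_
    rw [Matrix.mul_diagonal, Matrix.conjTranspose_apply, mul_right_comm, ← starRingEnd_apply,
      Complex.conj_mul', mul_comm]
  rw [this, Complex.ofReal_re]

end UnitaryHaar

/-! ### Ratios of characteristic polynomials and an Andréief identity -/

section PolynomialEnsemble

variable {n : ℕ}

/-- The left side interpolates the values (u-l_a)/(v-l_a) and is evaluated at u. In barycentric form
u-l_a cancels, leaving the barycentric sum at v for the constant 1, namely 1/∏(v-l_a). -/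
lemma Lagrange.sum_div_mul_eval_basis (hn : 0 < n) {l : Fin n → ℝ} (hl : Function.Injective l)
    {u v : ℝ} (hu : ∀ a, u ≠ l a) (hv : ∀ a, v ≠ l a) :
    ∑ a, (u - l a) / (v - l a) * (Lagrange.basis Finset.univ l a).eval u =
      ∏ a, (u - l a) / (v - l a) := by
  have hne : (Finset.univ : Finset (Fin n)).Nonempty := ⟨⟨0, hn⟩, Finset.mem_univ _⟩
  have hinj : InjOn l (Finset.univ : Finset (Fin n)) := hl.injOn
  set r : Fin n → ℝ := fun a => (u - l a) / (v - l a) with hr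
  have h1 := Lagrange.eval_interpolate_not_at_node (s := Finset.univ) (v := l) (1 : Fin n → ℝ)
    fun a _ => hv a
  rw [Lagrange.interpolate_one hinj hne, Polynomial.eval_one] at h1
  have h2 := Lagrange.eval_interpolate_not_at_node (s := Finset.univ) (v := l) r fun a _ => hu a
  have h3 : (Lagrange.interpolate Finset.univ l r).eval u =
      ∑ a, r a * (Lagrange.basis Finset.univ l a).eval u := by
    rw [Lagrange.interpolate_apply, Polynomial.eval_finsetSum]
    simp
  have h4 : ∑ a, Lagrange.nodalWeight Finset.univ l a * (u - l a)⁻¹ * r a =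
      ∑ a, Lagrange.nodalWeight Finset.univ l a * (v - l a)⁻¹ * (1 : Fin n → ℝ) a := by
    refine Finset.sum_congr rfl fun a _ => ?_
    have := sub_ne_zero.2 (hu a)
    simp only [hr, Pi.one_apply]
    field_simp
  rw [← h3, h2, h4, Finset.prod_div_distrib, ← Lagrange.eval_nodal, ← Lagrange.eval_nodal,
    eq_div_iff (by
      rw [Lagrange.eval_nodal]
      exact Finset.prod_ne_zero_iff.2 fun a _ => sub_ne_zero.2 (hv a)), mul_assoc,
    mul_comm _ (Polynomial.eval v _), ← h1, mul_one]

/-- Every p_j has degree below n, so Lagrange interpolation writes the row at u as a combination of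
the rows at the nodes; only row a contributes to the determinant. -/
lemma Matrix.det_updateRow_eval {p : Fin n → Polynomial ℝ} (hp : ∀ a, (p a).natDegree = (a : ℕ))
    {l : Fin n → ℝ} (hl : Function.Injective l) (u : ℝ) (a : Fin n) :
    ((Matrix.of fun i j => (p j).eval (l i)).updateRow a fun j => (p j).eval u).det =
      (Lagrange.basis Finset.univ l a).eval u * (Matrix.of fun i j => (p j).eval (l i)).det := by
  have h : (fun j => (p j).eval u) = ∑ b, (Lagrange.basis Finset.univ l b).eval u •
      (Matrix.of fun i j => (p j).eval (l i)) b := by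
    ext j
    have hd : (p j).degree < (Finset.univ : Finset (Fin n)).card := by
      refine Polynomial.degree_le_natDegree.trans_lt ?_
      rw [hp j, Finset.card_univ, Fintype.card_fin]
      exact_mod_cast j.2
    have := congrArg (Polynomial.eval u)
      (Lagrange.eq_interpolate (s := Finset.univ) (v := l) hl.injOn hd)
    rw [this, Lagrange.interpolate_apply, Polynomial.eval_finsetSum]
    simp [mul_comm]
  rw [h, Matrix.det_updateRow_sum]
  rfl

lemma polynomialEnsembleDensity_eq {p : Fin n → Polynomial ℝ} {q : Fin n → ℝ → ℝ}
    (h : IsBiorthonormalSystem p q) (l : Fin n → ℝ) :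
    polynomialEnsembleDensity q l = 1 / (n.factorial : ℝ) *
      ((Matrix.of fun i j => (p j).eval (l i)).det * (Matrix.of fun i j => q j (l i)).det) := by
  rw [polynomialEnsembleDensity, ← Matrix.det_eval_matrixOfPolynomials_eq_det_vandermonde l p
    (fun i => h.natDegree_eq i) h.monic, Matrix.det_vandermonde, mul_assoc]
  congr 2
  refine Finset.prod_comm' fun x y => ?_
  simp

lemma polynomialEnsembleDensity_mul_prod (hn : 0 < n) {p : Fin n → Polynomial ℝ}
    {q : Fin n → ℝ → ℝ} (h : IsBiorthonormalSystem p q) {l : Fin n → ℝ}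
    {u v : ℝ} (hu : ∀ a, u ≠ l a) (hv : ∀ a, v ≠ l a) :
    polynomialEnsembleDensity q l * ∏ a, (u - l a) / (v - l a) = 1 / (n.factorial : ℝ) *
      ∑ a, (u - l a) / (v - l a) *
        (((Matrix.of fun i j => (p j).eval (l i)).updateRow a fun j => (p j).eval u).det *
          (Matrix.of fun i j => q j (l i)).det) := by
  rw [polynomialEnsembleDensity_eq h]
  by_cases hl : Function.Injective l
  · simp_rw [Matrix.det_updateRow_eval h.natDegree_eq hl]
    rw [← Lagrange.sum_div_mul_eval_basis hn hl hu hv, mul_assoc, Finset.mul_sum]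
    congr 1
    refine Finset.sum_congr rfl fun a _ => ?_
    ring
  -- At coinciding eigenvalues the determinant of the weights vanishes, and with it both sides.
  · obtain ⟨a, b, hab, hne⟩ : ∃ a b, l a = l b ∧ a ≠ b := by
      simpa [Function.Injective] using hl
    have h0 : (Matrix.of fun i j => q j (l i)).det = 0 :=
      Matrix.det_zero_of_row_eq hne (by ext j; simp [hab])
    simp [h0]

section Andreief

variable {p : Fin n → Polynomial ℝ} {q : Fin n → ℝ → ℝ} {G : ℝ → ℝ}

/-- The one-variable factors in the expansion of the integrand of `integral_updateRow_det_mul_det`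
over pairs of permutations. -/
noncomputable def andreiefFactor (p : Fin n → Polynomial ℝ) (q : Fin n → ℝ → ℝ) (G : ℝ → ℝ)
    (c : Fin n → ℝ) (a : Fin n) (σ τ : Equiv.Perm (Fin n)) (i : Fin n) (x : ℝ) : ℝ :=
  if i = a then c (σ i) * (G x * q (τ i) x) else (p (σ i)).eval x * q (τ i) x

lemma updateRow_det_mul_det_eq_sum (c : Fin n → ℝ) (l : Fin n → ℝ) :
    ∑ a, G (l a) * (((Matrix.of fun i j => (p j).eval (l i)).updateRow a c).det *
        (Matrix.of fun i j => q j (l i)).det) =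
      ∑ a, ∑ σ : Equiv.Perm (Fin n), ∑ τ : Equiv.Perm (Fin n),
        ((Equiv.Perm.sign σ : ℤ) : ℝ) * ((Equiv.Perm.sign τ : ℤ) : ℝ) *
          ∏ i, andreiefFactor p q G c a σ τ i (l i) := by
  refine Finset.sum_congr rfl fun a _ => ?_
  rw [← Matrix.det_transpose, Matrix.det_apply', ← Matrix.det_transpose (Matrix.of _),
    Matrix.det_apply', Finset.sum_mul_sum, Finset.mul_sum]
  refine Finset.sum_congr rfl fun σ _ => ?_
  rw [Finset.mul_sum]
  refine Finset.sum_congr rfl fun τ _ => ?_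
  have hG : G (l a) = ∏ i, if i = a then G (l i) else 1 := by simp
  have : ∏ i, andreiefFactor p q G c a σ τ i (l i) = G (l a) *
      ((∏ i, ((Matrix.of fun i j => (p j).eval (l i)).updateRow a c)ᵀ (σ i) i) *
        ∏ i, (Matrix.of fun i j => q j (l i))ᵀ (τ i) i) := by
    rw [hG, ← Finset.prod_mul_distrib, ← Finset.prod_mul_distrib]
    refine Finset.prod_congr rfl fun i _ => ?_
    by_cases hi : i = a
    · subst hi
      simp [andreiefFactor]
      ring
    · simp [andreiefFactor, hi]
  rw [this]
  ring

lemma integrable_andreiefFactor (h : IsBiorthonormalSystem p q)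
    (hG : ∀ j, IntegrableOn (fun x => G x * q j x) (Ioi 0)) (c : Fin n → ℝ) (a : Fin n)
    (σ τ : Equiv.Perm (Fin n)) (i : Fin n) :
    Integrable (andreiefFactor p q G c a σ τ i) (volume.restrict (Ioi 0)) := by
  unfold andreiefFactor
  split_ifs
  · exact (hG _).const_mul _
  · exact h.integrable _ _

lemma integral_andreiefFactor (h : IsBiorthonormalSystem p q) (c : Fin n → ℝ) (a : Fin n)
    (σ τ : Equiv.Perm (Fin n)) (i : Fin n) :
    ∫ x in Ioi (0 : ℝ), andreiefFactor p q G c a σ τ i x =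
      if i = a then c (σ i) * ∫ x in Ioi (0 : ℝ), G x * q (τ i) x
        else if σ i = τ i then 1 else 0 := by
  unfold andreiefFactor
  split_ifs with h1 h2
  · rw [integral_const_mul]
  · rw [h.biorthonormal, if_pos h2]
  · rw [h.biorthonormal, if_neg h2]

/-- Permutations that agree off one point are equal. -/
lemma Equiv.Perm.eq_of_forall_ne {σ τ : Equiv.Perm (Fin n)} {a : Fin n}
    (h : ∀ i, i ≠ a → σ i = τ i) : σ = τ := by
  ext1 i
  by_cases hi : i = a
  · subst hi
    by_contra hne
    obtain ⟨j, hj⟩ := τ.surjective (σ i)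
    have hji : j ≠ i := by
      rintro rfl
      exact hne hj.symm
    exact hji (σ.injective ((h j hji).trans hj))
  · exact h i hi

/-- An Andréief identity with one row replaced. -/
lemma integral_updateRow_det_mul_det (h : IsBiorthonormalSystem p q)
    (hG : ∀ j, IntegrableOn (fun x => G x * q j x) (Ioi 0)) (c : Fin n → ℝ) :
    ∫ l, ∑ a, G (l a) * (((Matrix.of fun i j => (p j).eval (l i)).updateRow a c).det *
        (Matrix.of fun i j => q j (l i)).det)
          ∂(Measure.pi fun _ : Fin n => (volume : Measure ℝ).restrict (Ioi 0)) =
      n.factorial * ∑ j, c j * ∫ x in Ioi (0 : ℝ), G x * q j x := by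
  simp_rw [updateRow_det_mul_det_eq_sum]
  have hi : ∀ a σ τ, Integrable (fun l : Fin n → ℝ =>
      ((Equiv.Perm.sign σ : ℤ) : ℝ) * ((Equiv.Perm.sign τ : ℤ) : ℝ) *
        ∏ i, andreiefFactor p q G c a σ τ i (l i))
      (Measure.pi fun _ : Fin n => (volume : Measure ℝ).restrict (Ioi 0)) := fun a σ τ =>
    (Integrable.fintype_prod fun i => integrable_andreiefFactor h hG c a σ τ i).const_mul _
  rw [integral_finsetSum _ fun a _ => integrable_finsetSum _ fun σ _ =>
    integrable_finsetSum _ fun τ _ => hi a σ τ]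
  have hone : ∀ a (σ : Equiv.Perm (Fin n)), ∫ l, ∑ τ : Equiv.Perm (Fin n),
      ((Equiv.Perm.sign σ : ℤ) : ℝ) * ((Equiv.Perm.sign τ : ℤ) : ℝ) *
        ∏ i, andreiefFactor p q G c a σ τ i (l i)
          ∂(Measure.pi fun _ : Fin n => (volume : Measure ℝ).restrict (Ioi 0)) =
      c (σ a) * ∫ x in Ioi (0 : ℝ), G x * q (σ a) x := by
    intro a σ
    rw [integral_finsetSum _ fun τ _ => hi a σ τ]
    simp_rw [integral_const_mul, integral_fintype_prod_eq_prod, integral_andreiefFactor h]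
    -- Off the index a, biorthonormality forces τ = σ, and permutations agreeing off one point agree
    -- everywhere.
    rw [Finset.sum_eq_single σ]
    · rw [← Int.cast_mul, Int.units_coe_mul_self, Int.cast_one, one_mul]
      simp [Finset.prod_ite_eq']
    · intro τ _ hτ
      obtain ⟨i, hia, hi⟩ : ∃ i, i ≠ a ∧ σ i ≠ τ i := by
        by_contra! hc
        exact hτ (Equiv.Perm.eq_of_forall_ne hc).symm
      rw [Finset.prod_eq_zero (Finset.mem_univ i) (by simp [hia, hi]), mul_zero]
    · simp
  have htwo : ∀ a, ∫ l, ∑ σ : Equiv.Perm (Fin n), ∑ τ : Equiv.Perm (Fin n),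
      ((Equiv.Perm.sign σ : ℤ) : ℝ) * ((Equiv.Perm.sign τ : ℤ) : ℝ) *
        ∏ i, andreiefFactor p q G c a σ τ i (l i)
          ∂(Measure.pi fun _ : Fin n => (volume : Measure ℝ).restrict (Ioi 0)) =
      ∑ σ : Equiv.Perm (Fin n), c (σ a) * ∫ x in Ioi (0 : ℝ), G x * q (σ a) x := by
    intro a
    rw [integral_finsetSum _ fun σ _ => integrable_finsetSum _ fun τ _ => hi a σ τ]
    simp_rw [hone]
  simp_rw [htwo]
  -- For fixed σ, summing over a reindexes to a sum over j that does not depend on σ, hence the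
  -- factor n!.
  rw [Finset.sum_comm]
  simp_rw [fun σ : Equiv.Perm (Fin n) =>
    Equiv.sum_comp σ fun j => c j * ∫ x in Ioi (0 : ℝ), G x * q j x]
  rw [Finset.sum_const, Finset.card_univ, Fintype.card_perm, Fintype.card_fin, nsmul_eq_mul]

end Andreief

lemma integrableOn_weight (hn : 0 < n) {p : Fin n → Polynomial ℝ} {q : Fin n → ℝ → ℝ}
    (h : IsBiorthonormalSystem p q) (j : Fin n) : IntegrableOn (q j) (Ioi 0) := by
  have h0 : p ⟨0, hn⟩ = 1 := Polynomial.eq_one_of_monic_natDegree_zero (h.monic _) (h.natDegree_eq _)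
  have := h.integrable ⟨0, hn⟩ j
  rw [h0] at this
  simpa using this

lemma aemeasurable_polynomialEnsembleDensity (hn : 0 < n) {p : Fin n → Polynomial ℝ}
    {q : Fin n → ℝ → ℝ} (h : IsBiorthonormalSystem p q) :
    AEMeasurable (polynomialEnsembleDensity q)
      (Measure.pi fun _ : Fin n => (volume : Measure ℝ).restrict (Ioi 0)) := by
  have hq : ∀ i j : Fin n, AEMeasurable (fun l : Fin n → ℝ => q j (l i))
      (Measure.pi fun _ : Fin n => (volume : Measure ℝ).restrict (Ioi 0)) := fun i j =>
    (integrableOn_weight hn h j).aestronglyMeasurable.aemeasurable.comp_quasiMeasurePreserving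
      (Measure.quasiMeasurePreserving_eval _ i)
  unfold polynomialEnsembleDensity
  simp_rw [Matrix.det_apply']
  refine (AEMeasurable.mul ?_ ?_)
  · exact Measurable.aemeasurable (by fun_prop)
  · refine Finset.aemeasurable_fun_sum _ fun σ _ => AEMeasurable.const_mul ?_ _
    exact Finset.aemeasurable_fun_prod _ fun i _ => hq (σ i) i

end PolynomialEnsemble

/-! ### Identifying a law with a signed density -/

/-- A finite measure on `(0, ∞)` that integrates the functions `((1 + g) / (1 + g + s)) ^ n` like
the signed density `ρ` has density `ρ`. -/
lemma eq_withDensity_of_forall_integral_div_pow_eq {L : Measure ℝ} [IsFiniteMeasure L]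
    (hL : ∀ᵐ g ∂L, 0 < g) {ρ : ℝ → ℝ} (hρ : IntegrableOn ρ (Ioi 0)) {n : ℕ} (hn : 0 < n)
    (h : ∀ s : ℝ, |s| < 1 / 2 → ∫ g, ((1 + g) / (1 + g + s)) ^ n ∂L =
      ∫ g in Ioi (0 : ℝ), ((1 + g) / (1 + g + s)) ^ n * ρ g) :
    (∀ᵐ g ∂(volume.restrict (Ioi (0 : ℝ))), 0 ≤ ρ g) ∧
      L = (volume.restrict (Ioi (0 : ℝ))).withDensity fun g => ENNReal.ofReal (ρ g) := by
  set μ : Measure ℝ := volume.restrict (Ioi (0 : ℝ)) with hμ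
  have hint : Integrable ρ μ := hρ
  have hpm : AEMeasurable (fun g => ENNReal.ofReal (ρ g)) μ := hint.aemeasurable.ennreal_ofReal
  have hnm : AEMeasurable (fun g => ENNReal.ofReal (-ρ g)) μ :=
    hint.aemeasurable.neg.ennreal_ofReal
  set νp := μ.withDensity fun g => ENNReal.ofReal (ρ g) with hνp
  set νn := μ.withDensity fun g => ENNReal.ofReal (-ρ g) with hνn
  have : IsFiniteMeasure νp := isFiniteMeasure_withDensity_ofReal hint.2
  have : IsFiniteMeasure νn := isFiniteMeasure_withDensity_ofReal hint.neg.2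
  have hpos : ∀ᵐ g ∂μ, 0 < g := ae_restrict_mem measurableSet_Ioi
  have hνp0 : ∀ᵐ g ∂νp, 0 < g := (withDensity_absolutelyContinuous _ _).ae_le hpos
  have hνn0 : ∀ᵐ g ∂νn, 0 < g := (withDensity_absolutelyContinuous _ _).ae_le hpos
  have hbd : ∀ s : ℝ, |s| < 1 / 2 → ∀ g : ℝ, 0 < g → ‖((1 + g) / (1 + g + s)) ^ n‖ ≤ 2 ^ n := by
    intro s hs g hg
    have h1 := (abs_lt.1 hs).1
    have h2 : 0 < 1 + g + s := by linarith
    rw [norm_pow, Real.norm_of_nonneg (by positivity)]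
    refine pow_le_pow_left₀ (by positivity) ?_ n
    rw [div_le_iff₀ h2]
    linarith
  have hti : ∀ (κ : Measure ℝ) [IsFiniteMeasure κ], (∀ᵐ g ∂κ, 0 < g) → ∀ s : ℝ, |s| < 1 / 2 →
      Integrable (fun g => ((1 + g) / (1 + g + s)) ^ n) κ := by
    intro κ _ hκ s hs
    refine Integrable.of_bound (Measurable.aestronglyMeasurable (by fun_prop)) (2 ^ n) ?_
    filter_upwards [hκ] with g hg using hbd s hs g hg
  -- The negative part is moved to the other side, so that uniqueness is applied to genuine finite
  -- measures.
  have key : L + νn = νp := by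
    refine Measure.ext_of_forall_integral_div_pow_eq ?_ hνp0 hn fun s hs => ?_
    · rw [ae_add_measure_iff]
      exact ⟨hL, hνn0⟩
    · rw [integral_add_measure (hti L hL s hs) (hti νn hνn0 s hs), h s hs, hνn, hνp,
        integral_withDensity_eq_integral_toReal_smul₀ hnm (ae_of_all _ fun _ =>
          ENNReal.ofReal_lt_top),
        integral_withDensity_eq_integral_toReal_smul₀ hpm (ae_of_all _ fun _ =>
          ENNReal.ofReal_lt_top)]
      have hb : ∀ᵐ g ∂μ, ‖((1 + g) / (1 + g + s)) ^ n‖ ≤ 2 ^ n := by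
        filter_upwards [hpos] with g hg using hbd s hs g hg
      have hm : AEStronglyMeasurable (fun g : ℝ => ((1 + g) / (1 + g + s)) ^ n) μ :=
        Measurable.aestronglyMeasurable (by fun_prop)
      have i1 : Integrable (fun g => ((1 + g) / (1 + g + s)) ^ n * ρ g) μ := hint.bdd_mul hm hb
      have i2 : Integrable
          (fun g => (ENNReal.ofReal (-ρ g)).toReal • ((1 + g) / (1 + g + s)) ^ n) μ := by
        refine (hint.neg.real_toNNReal.bdd_mul hm hb).congr (ae_of_all _ fun g => ?_)
        simp only [smul_eq_mul]
        rw [mul_comm]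
        rfl
      rw [← integral_add i1 i2]
      refine integral_congr_ae (ae_of_all _ fun g => ?_)
      simp only [smul_eq_mul, ENNReal.toReal_ofReal']
      rcases le_total 0 (ρ g) with h0 | h0
      · rw [max_eq_left h0, max_eq_right (by linarith)]
        ring
      · rw [max_eq_right h0, max_eq_left (by linarith)]
        ring
  -- Since L ≥ 0, the negative part of ρ is almost everywhere at most its positive part, which
  -- excludes ρ < 0.
  have hle : (fun g => ENNReal.ofReal (-ρ g)) ≤ᵐ[μ] fun g => ENNReal.ofReal (ρ g) := by
    refine ae_le_of_forall_setLIntegral_le_of_sigmaFinite₀ hnm fun t ht _ => ?_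
    rw [← withDensity_apply _ ht, ← withDensity_apply _ ht, ← hνn, ← hνp, ← key]
    simp
  have hnn : ∀ᵐ g ∂μ, 0 ≤ ρ g := by
    filter_upwards [hle] with g hg
    by_contra! hc
    rw [ENNReal.ofReal_of_nonpos hc.le, nonpos_iff_eq_zero, ENNReal.ofReal_eq_zero] at hg
    linarith
  refine ⟨hnn, ?_⟩
  have h0 : νn = 0 := by
    rw [hνn, withDensity_eq_zero_iff hnm]
    filter_upwards [hnn] with g hg
    simp [hg]
  rw [← key, h0, add_zero]

/-! ### The SINR for a fixed spectrum -/

section Receiver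

variable {n : ℕ}

/-- The output SINR as a function of the Gram matrix `M = Hᴴ H`. -/
noncomputable def gramSINR (δ : ℝ) (k : Fin n) (M : Matrix (Fin n) (Fin n) ℂ) : ℝ :=
  1 / ((1 + (δ : ℂ) • M : Matrix (Fin n) (Fin n) ℂ)⁻¹ k k).re - 1

lemma measurable_gramSINR (δ : ℝ) (k : Fin n) : Measurable (gramSINR δ k) := by
  have h1 : Continuous fun M : Matrix (Fin n) (Fin n) ℂ => 1 + (δ : ℂ) • M := by fun_prop
  have h2 : Measurable fun M : Matrix (Fin n) (Fin n) ℂ => (1 + (δ : ℂ) • M)⁻¹ k k := by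
    simp_rw [Matrix.inv_def, Ring.inverse_eq_inv', Matrix.smul_apply, smul_eq_mul]
    exact (h1.matrix_det.measurable.inv).mul (h1.matrix_adjugate.matrix_elem k k).measurable
  unfold gramSINR
  exact ((Complex.measurable_re.comp h2).const_div 1).sub_const 1

lemma measurable_unitaryConjDiagonal : Measurable
    fun Ul : Matrix.unitaryGroup (Fin n) ℂ × (Fin n → ℝ) => unitaryConjDiagonal Ul.1 Ul.2 := by
  refine Continuous.measurable ?_
  unfold unitaryConjDiagonal
  have h1 : Continuous fun Ul : Matrix.unitaryGroup (Fin n) ℂ × (Fin n → ℝ) =>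
    (Ul.1 : Matrix (Fin n) (Fin n) ℂ) := continuous_subtype_val.comp continuous_fst
  exact (h1.matrix_conjTranspose.mul (Continuous.matrix_diagonal (by fun_prop))).mul h1

lemma unitaryColumnForm_one_add_mul (s : ℝ) (D : Fin n → ℝ) (k : Fin n)
    (U : Matrix.unitaryGroup (Fin n) ℂ) :
    unitaryColumnForm (fun a => 1 + s * D a) k U = 1 + s * unitaryColumnForm D k U := by
  unfold unitaryColumnForm
  simp_rw [add_mul, one_mul, Finset.sum_add_distrib, sum_norm_sq_unitary_col, Finset.mul_sum,
    mul_assoc]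

lemma gramSINR_unitaryConjDiagonal {δ : ℝ} (hδ : 0 < δ) {l : Fin n → ℝ} (hl : ∀ a, 0 < l a)
    (U : Matrix.unitaryGroup (Fin n) ℂ) (k : Fin n) :
    gramSINR δ k (unitaryConjDiagonal U l) =
      1 / unitaryColumnForm (fun a => (1 + δ * l a)⁻¹) k U - 1 := by
  rw [gramSINR, inv_one_add_smul_unitaryConjDiagonal hδ hl, unitaryConjDiagonal_apply_self]

lemma unitaryColumnForm_inv_mem_Ioo {δ : ℝ} (hδ : 0 < δ) {l : Fin n → ℝ} (hl : ∀ a, 0 < l a)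
    (U : Matrix.unitaryGroup (Fin n) ℂ) (k : Fin n) :
    unitaryColumnForm (fun a => (1 + δ * l a)⁻¹) k U ∈ Ioo (0 : ℝ) 1 := by
  have h1 : ∀ a, 1 < 1 + δ * l a := fun a => by linarith [mul_pos hδ (hl a)]
  refine ⟨unitaryColumnForm_pos (fun a => inv_pos.2 (zero_lt_one.trans (h1 a))) k U, ?_⟩
  -- Positivity of the form with weights 1 - (1+δl_a)⁻¹ is the upper bound, because the columns are
  -- unit vectors.
  have h2 := unitaryColumnForm_pos (D := fun a => 1 + (-1) * (1 + δ * l a)⁻¹)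
    (fun a => by linarith [inv_lt_one_of_one_lt₀ (h1 a)]) k U
  rw [unitaryColumnForm_one_add_mul] at h2
  linarith

lemma gramSINR_unitaryConjDiagonal_pos {δ : ℝ} (hδ : 0 < δ) {l : Fin n → ℝ} (hl : ∀ a, 0 < l a)
    (U : Matrix.unitaryGroup (Fin n) ℂ) (k : Fin n) :
    0 < gramSINR δ k (unitaryConjDiagonal U l) := by
  have h := unitaryColumnForm_inv_mem_Ioo hδ hl U k
  rw [gramSINR_unitaryConjDiagonal hδ hl, sub_pos, lt_one_div one_pos h.1, one_div_one]
  exact h.2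

lemma div_gramSINR_unitaryConjDiagonal_pow {δ : ℝ} (hδ : 0 < δ) {l : Fin n → ℝ}
    (hl : ∀ a, 0 < l a) (U : Matrix.unitaryGroup (Fin n) ℂ) (k : Fin n) {s : ℝ} (hs : -1 < s) :
    ((1 + gramSINR δ k (unitaryConjDiagonal U l)) /
        (1 + gramSINR δ k (unitaryConjDiagonal U l) + s)) ^ n =
      (unitaryColumnForm (fun a => 1 + s * (1 + δ * l a)⁻¹) k U ^ n)⁻¹ := by
  have h := unitaryColumnForm_inv_mem_Ioo hδ hl U k
  rw [unitaryColumnForm_one_add_mul, gramSINR_unitaryConjDiagonal hδ hl, ← inv_pow]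
  congr 1
  set X := unitaryColumnForm (fun a => (1 + δ * l a)⁻¹) k U
  have h0 := h.1
  have h2 : 0 < 1 + s * X := by nlinarith [h.2]
  have h3 : 1 + (1 / X - 1) + s = (1 + s * X) / X := by field_simp; ring
  rw [h3]
  field_simp
  ring

/-- The average over the unitary group of the test functions that determine the law of the SINR. -/
lemma integral_div_gramSINR_pow {δ : ℝ} (hδ : 0 < δ) {l : Fin n → ℝ}
    (hl : ∀ a, 0 < l a) (k : Fin n) {s : ℝ} (hs : -1 < s) :
    ∫ U, ((1 + gramSINR δ k (unitaryConjDiagonal U l)) /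
        (1 + gramSINR δ k (unitaryConjDiagonal U l) + s)) ^ n ∂unitaryHaar n =
      ∏ a, (1 + δ * l a) / (1 + δ * l a + s) := by
  simp_rw [div_gramSINR_unitaryConjDiagonal_pow hδ hl _ k hs]
  have h1 : ∀ a, 1 < 1 + δ * l a := fun a => by linarith [mul_pos hδ (hl a)]
  have h2 : ∀ a, 1 + s * (1 + δ * l a)⁻¹ = (1 + δ * l a + s) / (1 + δ * l a) := fun a => by
    have := h1 a
    field_simp
  rw [integral_unitaryColumnForm fun a => ?_]
  · refine Finset.prod_congr rfl fun a _ => ?_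
    rw [h2 a, inv_div]
  · have := h1 a
    rw [h2 a]
    exact div_pos (by linarith) (by linarith)

end Receiver

/-! ### Averages over the eigenvalue law -/

section Ensemble

variable {n : ℕ} {p : Fin n → Polynomial ℝ} {q : Fin n → ℝ → ℝ}

/-- The eigenvalue law of a polynomial ensemble. -/
noncomputable def polynomialEnsembleLaw (q : Fin n → ℝ → ℝ) : Measure (Fin n → ℝ) :=
  (volume.restrict (univ.pi fun _ : Fin n => Ioi (0 : ℝ))).withDensity
    fun l => ENNReal.ofReal (polynomialEnsembleDensity q l)

lemma volume_restrict_pi_Ioi : (volume : Measure (Fin n → ℝ)).restrict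
    (univ.pi fun _ : Fin n => Ioi (0 : ℝ)) =
      Measure.pi fun _ : Fin n => (volume : Measure ℝ).restrict (Ioi 0) := by
  rw [volume_pi, Measure.restrict_pi_pi]

lemma ae_polynomialEnsembleLaw_pos : ∀ᵐ l ∂polynomialEnsembleLaw q, ∀ a, 0 < l a := by
  refine (withDensity_absolutelyContinuous _ _).ae_le ?_
  filter_upwards [ae_restrict_mem (MeasurableSet.univ_pi fun _ => measurableSet_Ioi)] with l hl a
    using hl a (mem_univ a)

lemma integrableOn_polynomialEnsembleKernel_mul {f : ℝ → ℝ} (u : ℝ)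
    (hf : ∀ j, IntegrableOn (fun y => f y * q j y) (Ioi 0)) :
    IntegrableOn (fun y => polynomialEnsembleKernel p q u y * f y) (Ioi 0) ∧
      ∫ y in Ioi (0 : ℝ), polynomialEnsembleKernel p q u y * f y =
        ∑ j, (p j).eval u * ∫ y in Ioi (0 : ℝ), f y * q j y := by
  have h : (fun y => polynomialEnsembleKernel p q u y * f y) =
      fun y => ∑ j, (p j).eval u * (f y * q j y) := by
    ext y
    rw [polynomialEnsembleKernel, Finset.sum_mul]
    exact Finset.sum_congr rfl fun j _ => by ring
  rw [h]
  refine ⟨integrable_finsetSum _ fun j _ => (hf j).const_mul _, ?_⟩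
  rw [integral_finsetSum _ fun j _ => (hf j).const_mul _]
  simp_rw [integral_const_mul]

/-- Because p_0 = 1, biorthonormality makes ∫ q_j vanish unless j = 0, and only p_0(u) = 1 survives.
-/
lemma integrableOn_polynomialEnsembleKernel (hn : 0 < n) (h : IsBiorthonormalSystem p q) (u : ℝ) :
    IntegrableOn (polynomialEnsembleKernel p q u) (Ioi 0) ∧
      ∫ y in Ioi (0 : ℝ), polynomialEnsembleKernel p q u y = 1 := by
  have h0 : p ⟨0, hn⟩ = 1 := Polynomial.eq_one_of_monic_natDegree_zero (h.monic _) (h.natDegree_eq _)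
  have hq := integrableOn_weight hn h
  have h1 := integrableOn_polynomialEnsembleKernel_mul (p := p) (q := q) (f := fun _ => 1) u
    (by simpa using hq)
  simp only [mul_one, one_mul] at h1
  refine ⟨h1.1, h1.2.trans ?_⟩
  have h2 : ∀ j, ∫ y in Ioi (0 : ℝ), q j y = if ⟨0, hn⟩ = j then 1 else 0 := by
    intro j
    rw [← h.biorthonormal, h0]
    simp
  simp [h2, h0]

/-- The bound log(1+δy) ≤ δy reduces this to y q_j(y), and y is p_1(y) minus a constant; this is
where n ≥ 2 enters. -/
lemma integrableOn_log_mul_weight (hn : 2 ≤ n) (h : IsBiorthonormalSystem p q) {δ : ℝ}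
    (hδ : 0 < δ) (j : Fin n) : IntegrableOn (fun y => Real.log (1 + δ * y) * q j y) (Ioi 0) := by
  have hq := integrableOn_weight (by omega) h j
  have hp1 := h.integrable ⟨1, hn⟩ j
  have hx : IntegrableOn (fun y => y * q j y) (Ioi 0) := by
    have hc := (h.monic ⟨1, hn⟩).eq_X_add_C (h.natDegree_eq _)
    set c := (p ⟨1, hn⟩).coeff 0
    refine (hp1.sub (hq.const_mul c)).congr (ae_of_all _ fun y => ?_)
    simp [hc]
    ring
  refine (hx.const_mul δ).mono ?_ ?_
  · exact (Measurable.aestronglyMeasurable (by fun_prop)).mul hq.aestronglyMeasurable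
  · filter_upwards [ae_restrict_mem measurableSet_Ioi] with y (hy : 0 < y)
    have h1 : 0 < δ * y := mul_pos hδ hy
    rw [← mul_assoc, norm_mul, norm_mul (δ * y), Real.norm_of_nonneg h1.le,
      Real.norm_of_nonneg (Real.log_nonneg (by linarith))]
    gcongr
    linarith [Real.log_le_sub_one_of_pos (show 0 < 1 + δ * y by linarith)]

lemma integral_polynomialEnsembleLaw_prod (hn : 0 < n) (h : IsBiorthonormalSystem p q)
    (hnn : ∀ᵐ l ∂(volume.restrict (univ.pi fun _ : Fin n => Ioi (0 : ℝ))),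
      0 ≤ polynomialEnsembleDensity q l) {δ : ℝ} (hδ : 0 < δ) {s : ℝ} (hs : -1 < s) :
    IntegrableOn (fun y => polynomialEnsembleKernel p q (-1 / δ) y *
        ((1 + δ * y) / (1 + δ * y + s))) (Ioi 0) ∧
      ∫ l, ∏ a, (1 + δ * l a) / (1 + δ * l a + s) ∂polynomialEnsembleLaw q =
        ∫ y in Ioi (0 : ℝ), polynomialEnsembleKernel p q (-1 / δ) y *
          ((1 + δ * y) / (1 + δ * y + s)) := by
  set G : ℝ → ℝ := fun y => (1 + δ * y) / (1 + δ * y + s) with hG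
  have hGq : ∀ j, IntegrableOn (fun y => G y * q j y) (Ioi 0) := by
    intro j
    -- The bound comes from G(y) = 1 - s/(1+δy+s), whose denominator exceeds 1 + s > 0.
    refine (integrableOn_weight hn h j).bdd_mul (c := (1 + |s| / (1 + s)))
      (Measurable.aestronglyMeasurable (by fun_prop)) ?_
    filter_upwards [ae_restrict_mem measurableSet_Ioi] with y (hy : 0 < y)
    have h1 : 0 < δ * y := mul_pos hδ hy
    have h2 : 0 < 1 + δ * y + s := by linarith
    have h3 : 0 < 1 + s := by linarith
    have h4 : G y = 1 + (-s) / (1 + δ * y + s) := by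
      simp only [hG]
      field_simp
      ring
    rw [h4]
    refine (norm_add_le _ _).trans ?_
    rw [norm_one, norm_div, norm_neg, Real.norm_eq_abs, Real.norm_of_nonneg h2.le]
    gcongr
    linarith
  have hK := integrableOn_polynomialEnsembleKernel_mul (p := p) (q := q) (-1 / δ) hGq
  refine ⟨hK.1, ?_⟩
  rw [hK.2, polynomialEnsembleLaw, volume_restrict_pi_Ioi]
  rw [volume_restrict_pi_Ioi] at hnn
  rw [integral_withDensity_eq_integral_toReal_smul₀
    (aemeasurable_polynomialEnsembleDensity hn h).ennreal_ofReal
    (ae_of_all _ fun _ => ENNReal.ofReal_lt_top)]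
  have hpos : ∀ᵐ l ∂(Measure.pi fun _ : Fin n => (volume : Measure ℝ).restrict (Ioi 0)),
      ∀ a, 0 < l a := by
    rw [← volume_restrict_pi_Ioi]
    filter_upwards [ae_restrict_mem (MeasurableSet.univ_pi fun _ => measurableSet_Ioi)] with l hl a
      using hl a (mem_univ a)
  have he : ∀ y, 0 < y → (-1 / δ - y) / (-(1 + s) / δ - y) = G y := by
    intro y hy
    have h1 : 0 < δ * y := mul_pos hδ hy
    have h2 : 0 < 1 + δ * y + s := by linarith
    have h5 : -(1 + s) / δ - y = -(1 + δ * y + s) / δ := by field_simp; ring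
    have h6 : -1 / δ - y = -(1 + δ * y) / δ := by field_simp; ring
    rw [h5, h6, div_div_div_cancel_right₀ hδ.ne', neg_div_neg_eq]
  have hfac : (n.factorial : ℝ) ≠ 0 := by exact_mod_cast n.factorial_ne_zero
  have := integral_updateRow_det_mul_det h hGq fun j => (p j).eval (-1 / δ)
  rw [← mul_right_inj' (one_div_ne_zero hfac), ← mul_assoc, one_div_mul_cancel hfac, one_mul,
    ← integral_const_mul] at this
  rw [← this]
  refine integral_congr_ae ?_
  filter_upwards [hpos, hnn] with l hl hd
  have hu : ∀ a, -1 / δ ≠ l a := fun a => by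
    have : -1 / δ < 0 := div_neg_of_neg_of_pos (by norm_num) hδ
    exact (this.trans (hl a)).ne
  have hv : ∀ a, -(1 + s) / δ ≠ l a := fun a => by
    have : -(1 + s) / δ < 0 := div_neg_of_neg_of_pos (by linarith) hδ
    exact (this.trans (hl a)).ne
  have h7 := polynomialEnsembleDensity_mul_prod hn h hu hv
  simp_rw [he _ (hl _)] at h7
  rw [ENNReal.toReal_ofReal hd, smul_eq_mul, h7]

end Ensemble

/-! ### Change of variables and the digamma value -/

/-- The substitution `y = g x / δ` turns the integral over `(0, 1)` into a mixture of the densities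
`sinrMixingKernel n (δ * y)`. -/
lemma integral_eq_integral_sinrMixingKernel {n : ℕ} (hn : 2 ≤ n) {δ : ℝ} (hδ : 0 < δ) (w : ℝ → ℝ)
    {g : ℝ} (hg : 0 < g) :
    ((n : ℝ) - 1) / δ * (g / (g + 1)) ^ n *
        ∫ x in (0 : ℝ)..1, (1 - x) ^ (n - 2) * (x + 1 / g) * w (g / δ * x) =
      ∫ y in Ioi (0 : ℝ), w y * sinrMixingKernel n (δ * y) g := by
  have hc : 0 < g / δ := div_pos hg hδ
  set f : ℝ → ℝ := fun y => (1 - y / (g / δ)) ^ (n - 2) * (y / (g / δ) + 1 / g) * w y with hf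
  have h1 : ∀ x, (1 - x) ^ (n - 2) * (x + 1 / g) * w (g / δ * x) = f (g / δ * x) := by
    intro x
    simp only [hf, mul_div_cancel_left₀ x hc.ne']
  simp_rw [h1]
  rw [intervalIntegral.integral_comp_mul_left f hc.ne', mul_zero, mul_one,
    intervalIntegral.integral_of_le hc.le, smul_eq_mul, integral_Ioc_eq_integral_Ioo,
    ← mul_assoc, ← integral_const_mul]
  have h2 : ∀ y, w y * sinrMixingKernel n (δ * y) g = (Iio (g / δ)).indicator (fun y => w y *
      (((n : ℝ) - 1) * (1 + δ * y) * (g - δ * y) ^ (n - 2) / (1 + g) ^ n)) y := by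
    intro y
    have : δ * y < g ↔ y < g / δ := by rw [lt_div_iff₀ hδ, mul_comm]
    by_cases hy : y < g / δ
    · simp [sinrMixingKernel, this.2 hy, hy]
    · simp [sinrMixingKernel, this, hy]
  simp_rw [h2]
  rw [setIntegral_indicator measurableSet_Iio, Ioi_inter_Iio]
  refine integral_congr_ae (ae_of_all _ fun y => ?_)
  have h3 : 1 - y / (g / δ) = (g - δ * y) / g := by field_simp
  have h4 : y / (g / δ) + 1 / g = (1 + δ * y) / g := by field_simp; ring
  obtain ⟨m, rfl⟩ := Nat.exists_eq_add_of_le' hn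
  have h5 : g + 1 ≠ 0 := by linarith
  simp only [hf, h3, h4, div_pow, Nat.add_sub_cancel]
  rw [add_comm 1 g]
  field_simp
  ring

lemma intervalIntegrable_weighted_comp_mul (n : ℕ) {c g : ℝ} (hc : 0 < c) {w : ℝ → ℝ}
    (hw : IntegrableOn w (Ioi 0)) :
    IntervalIntegrable (fun x => (1 - x) ^ (n - 2) * (x + 1 / g) * w (c * x)) volume 0 1 := by
  have h1 : IntervalIntegrable w volume 0 c := by
    rw [intervalIntegrable_iff_integrableOn_Ioc_of_le hc.le]
    exact hw.mono_set Ioc_subset_Ioi_self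
  have h2 := h1.comp_mul_left (c := c)
  rw [zero_div, div_self hc.ne'] at h2
  exact h2.continuousOn_mul (Continuous.continuousOn (by fun_prop))

lemma Real.logDeriv_Gamma_natCast {n : ℕ} (hn : 0 < n) :
    logDeriv Real.Gamma n = -Real.eulerMascheroniConstant + harmonic (n - 1) := by
  obtain ⟨m, rfl⟩ := Nat.exists_eq_add_of_le' hn
  have : (m.factorial : ℝ) ≠ 0 := by exact_mod_cast m.factorial_ne_zero
  rw [logDeriv_apply]
  push_cast
  rw [Real.deriv_Gamma_nat, Real.Gamma_nat_eq_factorial, mul_div_cancel_left₀ _ this]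

/-! ### Law of the SINR -/

section SINR

variable {Ω : Type*} [MeasurableSpace Ω] {P : Measure Ω} {nr nt : ℕ}
  {H : Ω → Matrix (Fin nr) (Fin nt) ℂ} {p : Fin nt → Polynomial ℝ} {q : Fin nt → ℝ → ℝ} {δ : ℝ}

lemma IsInvariantPolynomialEnsemble.aemeasurable_gram
    (hH : IsInvariantPolynomialEnsemble P H p q) : AEMeasurable (fun ω => (H ω)ᴴ * H ω) P := by
  have h : Continuous fun M : Matrix (Fin nr) (Fin nt) ℂ => Mᴴ * M :=
    continuous_id.matrix_conjTranspose.matrix_mul continuous_id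
  exact h.measurable.comp_aemeasurable hH.aemeasurable

lemma IsInvariantPolynomialEnsemble.aemeasurable_mmseSINR
    (hH : IsInvariantPolynomialEnsemble P H p q) (δ : ℝ) (k : Fin nt) :
    AEMeasurable (fun ω => mmseSINR δ (H ω) k) P :=
  (measurable_gramSINR δ k).comp_aemeasurable hH.aemeasurable_gram

lemma measurable_gramSINR_unitaryConjDiagonal (δ : ℝ) (k : Fin nt) :
    Measurable fun z : Matrix.unitaryGroup (Fin nt) ℂ × (Fin nt → ℝ) =>
      gramSINR δ k (unitaryConjDiagonal z.1 z.2) :=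
  (measurable_gramSINR δ k).comp measurable_unitaryConjDiagonal

lemma IsInvariantPolynomialEnsemble.map_mmseSINR
    (hH : IsInvariantPolynomialEnsemble P H p q) (δ : ℝ) (k : Fin nt) :
    P.map (fun ω => mmseSINR δ (H ω) k) =
      ((unitaryHaar nt).prod (polynomialEnsembleLaw q)).map
        fun z => gramSINR δ k (unitaryConjDiagonal z.1 z.2) := by
  have h1 : (P.map fun ω => (H ω)ᴴ * H ω).map (gramSINR δ k) =
      P.map fun ω => mmseSINR δ (H ω) k :=
    AEMeasurable.map_map_of_aemeasurable (measurable_gramSINR δ k).aemeasurable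
      hH.aemeasurable_gram
  rw [← h1, hH.map_gram]
  exact Measure.map_map (measurable_gramSINR δ k) measurable_unitaryConjDiagonal

lemma IsInvariantPolynomialEnsemble.map_gram_eq (hH : IsInvariantPolynomialEnsemble P H p q) :
    P.map (fun ω => (H ω)ᴴ * H ω) = ((unitaryHaar nt).prod (polynomialEnsembleLaw q)).map
      fun Ul => unitaryConjDiagonal Ul.1 Ul.2 := hH.map_gram

/-- No normalisation integral is computed: the Gram matrix and the Haar factor have mass one, hence
so does the eigenvalue law. -/
lemma IsInvariantPolynomialEnsemble.isProbabilityMeasure_law [IsProbabilityMeasure P]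
    (hH : IsInvariantPolynomialEnsemble P H p q) :
    IsProbabilityMeasure (polynomialEnsembleLaw q) := by
  have h1 : IsProbabilityMeasure (P.map fun ω => (H ω)ᴴ * H ω) :=
    Measure.isProbabilityMeasure_map hH.aemeasurable_gram
  have h2 := h1.measure_univ
  rw [hH.map_gram_eq, Measure.map_apply measurable_unitaryConjDiagonal MeasurableSet.univ,
    preimage_univ, ← univ_prod_univ] at h2
  refine ⟨?_⟩
  have : SFinite (polynomialEnsembleLaw q) := by
    unfold polynomialEnsembleLaw
    infer_instance
  rwa [Measure.prod_prod, measure_univ, one_mul] at h2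

lemma IsInvariantPolynomialEnsemble.ae_map_mmseSINR_pos [IsProbabilityMeasure P]
    (hH : IsInvariantPolynomialEnsemble P H p q) (hδ : 0 < δ) (k : Fin nt) :
    ∀ᵐ g ∂P.map (fun ω => mmseSINR δ (H ω) k), 0 < g := by
  have := hH.isProbabilityMeasure_law
  rw [hH.map_mmseSINR, ae_map_iff (measurable_gramSINR_unitaryConjDiagonal δ k).aemeasurable
    measurableSet_Ioi]
  filter_upwards [Measure.quasiMeasurePreserving_snd.ae (ae_polynomialEnsembleLaw_pos (q := q))]
    with z hz using gramSINR_unitaryConjDiagonal_pos hδ hz z.1 k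

/-- The transform `𝔼[((1 + γ) / (1 + γ + s)) ^ nt]` of the SINR in terms of the kernel. -/
lemma IsInvariantPolynomialEnsemble.integral_div_pow_map_mmseSINR [IsProbabilityMeasure P]
    (hH : IsInvariantPolynomialEnsemble P H p q) (hnt : 0 < nt) (hδ : 0 < δ) (k : Fin nt) {s : ℝ}
    (hs : -1 < s) :
    ∫ g, ((1 + g) / (1 + g + s)) ^ nt ∂P.map (fun ω => mmseSINR δ (H ω) k) =
      ∫ y in Ioi (0 : ℝ), polynomialEnsembleKernel p q (-1 / δ) y *
        ((1 + δ * y) / (1 + δ * y + s)) := by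
  have := hH.isProbabilityMeasure_law
  have hm := measurable_gramSINR_unitaryConjDiagonal (nt := nt) δ k
  have hfm : Measurable fun g : ℝ => ((1 + g) / (1 + g + s)) ^ nt := by fun_prop
  rw [← (integral_polynomialEnsembleLaw_prod hnt hH.system hH.density_nonneg hδ hs).2,
    hH.map_mmseSINR, integral_map hm.aemeasurable hfm.aestronglyMeasurable, integral_prod_symm]
  · refine integral_congr_ae ?_
    filter_upwards [ae_polynomialEnsembleLaw_pos (q := q)] with l hl
      using integral_div_gramSINR_pow hδ hl k hs
  · refine Integrable.of_bound (hfm.comp hm).aestronglyMeasurable ((1 + |s| / (1 + s)) ^ nt) ?_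
    filter_upwards [Measure.quasiMeasurePreserving_snd.ae (ae_polynomialEnsembleLaw_pos (q := q))]
      with z hz
    have h0 := gramSINR_unitaryConjDiagonal_pos hδ hz z.1 k
    set g := gramSINR δ k (unitaryConjDiagonal z.1 z.2)
    have h1 : 0 < 1 + s := by linarith
    have h2 : 0 < 1 + g + s := by linarith
    rw [norm_pow]
    refine pow_le_pow_left₀ (norm_nonneg _) ?_ _
    rw [show (1 + g) / (1 + g + s) = 1 + (-s) / (1 + g + s) by field_simp; ring]
    refine (norm_add_le _ _).trans ?_
    rw [norm_one, norm_div, norm_neg, Real.norm_eq_abs, Real.norm_of_nonneg h2.le]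
    gcongr
    linarith

end SINR

/-! ### Density of the SINR and the sum rate -/

theorem proposition2 {Ω : Type*} [MeasurableSpace Ω] (P : Measure Ω) [IsProbabilityMeasure P]
    (nr nt : ℕ) (hnt : 2 ≤ nt) (hnr : nt ≤ nr) (δ : ℝ) (hδ : 0 < δ)
    (H : Ω → Matrix (Fin nr) (Fin nt) ℂ)
    (p : Fin nt → Polynomial ℝ) (q : Fin nt → ℝ → ℝ)
    (hH : IsInvariantPolynomialEnsemble P H p q)
    (K : ℝ → ℝ → ℝ) (hK : K = polynomialEnsembleKernel p q)
    (ρ : ℝ → ℝ)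
    (hρ : ρ = fun g => ((nt : ℝ) - 1) / δ * (g / (g + 1)) ^ nt *
      ∫ x in (0 : ℝ)..1, (1 - x) ^ (nt - 2) * (x + 1 / g) * K (-1 / δ) (g / δ * x)) :
    -- the integral in the density converges absolutely for every positive argument
    (∀ g : ℝ, 0 < g → IntervalIntegrable
      (fun x => (1 - x) ^ (nt - 2) * (x + 1 / g) * K (-1 / δ) (g / δ * x)) volume 0 1) ∧
    -- `ρ` is the probability density on `(0, ∞)` of the SINR of every stream
    IntegrableOn ρ (Set.Ioi 0) ∧
    (∀ᵐ g ∂(volume.restrict (Set.Ioi (0 : ℝ))), 0 ≤ ρ g) ∧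
    (∀ k : Fin nt, AEMeasurable (fun ω => mmseSINR δ (H ω) k) P ∧
      P.map (fun ω => mmseSINR δ (H ω) k) =
        (volume.restrict (Set.Ioi (0 : ℝ))).withDensity fun g => ENNReal.ofReal (ρ g)) ∧
    -- the sum rate, with all expectations and integrals absolutely convergent
    (∀ k : Fin nt, Integrable (fun ω => Real.log (1 + mmseSINR δ (H ω) k)) P) ∧
    IntegrableOn (fun x => Real.log (1 + δ * x) * K (-1 / δ) x) (Set.Ioi 0) ∧
    mmseSumRate P δ H =
      nt * ((∫ x in Set.Ioi (0 : ℝ), Real.log (1 + δ * x) * K (-1 / δ) x) +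
        Real.eulerMascheroniConstant + logDeriv Real.Gamma nt) := by
  have hn0 : 0 < nt := by omega
  set u : ℝ := -1 / δ with hu
  have hw : IntegrableOn (K u) (Ioi 0) ∧ ∫ y in Ioi (0 : ℝ), K u y = 1 := by
    rw [hK]
    exact integrableOn_polynomialEnsembleKernel hn0 hH.system u
  have hρe : ∀ g, 0 < g → ρ g = ∫ y in Ioi (0 : ℝ), K u y * sinrMixingKernel nt (δ * y) g := by
    intro g hg
    rw [hρ]
    exact integral_eq_integral_sinrMixingKernel hnt hδ (K u) hg
  have hmix : ∀ {f F : ℝ → ℝ}, Measurable f → (∀ g, 0 < g → 0 ≤ f g) →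
      (∀ c, 0 < c → IntegrableOn (fun g => sinrMixingKernel nt c g * f g) (Ioi 0)) →
      (∀ c, 0 < c → ∫ g in Ioi (0 : ℝ), sinrMixingKernel nt c g * f g = F c) →
      IntegrableOn (fun y => K u y * F (δ * y)) (Ioi 0) →
      IntegrableOn (fun g => f g * ρ g) (Ioi 0) ∧
        ∫ g in Ioi (0 : ℝ), f g * ρ g = ∫ y in Ioi (0 : ℝ), K u y * F (δ * y) := by
    intro f F hf hf0 hfi hF hwF
    have h := integral_signed_mixture hnt hδ hw.1.aestronglyMeasurable hf hf0 hfi hF hwF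
    have he : EqOn (fun g => f g * ∫ y in Ioi (0 : ℝ), K u y * sinrMixingKernel nt (δ * y) g)
        (fun g => f g * ρ g) (Ioi 0) := fun g hg => by simp only [hρe g hg]
    exact ⟨h.1.congr_fun he measurableSet_Ioi,
      (setIntegral_congr_fun measurableSet_Ioi he).symm.trans h.2⟩
  have htest : ∀ s : ℝ, -1 < s →
      IntegrableOn (fun g => ((1 + g) / (1 + g + s)) ^ nt * ρ g) (Ioi 0) ∧
        ∫ g in Ioi (0 : ℝ), ((1 + g) / (1 + g + s)) ^ nt * ρ g =
          ∫ y in Ioi (0 : ℝ), K u y * ((1 + δ * y) / (1 + δ * y + s)) := by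
    intro s hs
    refine hmix (F := fun c => (1 + c) / (1 + c + s)) (by fun_prop) (fun g hg => ?_)
      (fun c hc => (integral_sinrMixingKernel_mul_pow hnt hc hs).1)
      (fun c hc => (integral_sinrMixingKernel_mul_pow hnt hc hs).2) ?_
    · have : 0 < 1 + g + s := by linarith
      positivity
    · rw [hK]
      exact (integral_polynomialEnsembleLaw_prod hn0 hH.system hH.density_nonneg hδ hs).1
  -- At s = 0 the test function is identically 1 on (0,∞).
  have hρi : IntegrableOn ρ (Ioi 0) := by
    refine (htest 0 (by norm_num)).1.congr_fun (fun g (hg : 0 < g) => ?_) measurableSet_Ioi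
    have : 1 + g ≠ 0 := by linarith
    simp [div_self this]
  have hmeas := hH.aemeasurable_mmseSINR δ
  have hprob : ∀ k, IsProbabilityMeasure (P.map fun ω => mmseSINR δ (H ω) k) := fun k =>
    Measure.isProbabilityMeasure_map (hmeas k)
  have hlaw : ∀ k : Fin nt, (∀ᵐ g ∂(volume.restrict (Ioi (0 : ℝ))), 0 ≤ ρ g) ∧
      P.map (fun ω => mmseSINR δ (H ω) k) =
        (volume.restrict (Ioi (0 : ℝ))).withDensity fun g => ENNReal.ofReal (ρ g) := by
    intro k
    have := hprob k
    refine eq_withDensity_of_forall_integral_div_pow_eq (hH.ae_map_mmseSINR_pos hδ k) hρi hn0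
      fun s hs => ?_
    have hs1 : -1 < s := by linarith [(abs_lt.1 hs).1]
    rw [hH.integral_div_pow_map_mmseSINR hn0 hδ k hs1, (htest s hs1).2, hK]
  have hlog : IntegrableOn (fun x => Real.log (1 + δ * x) * K u x) (Ioi 0) := by
    rw [hK]
    simp_rw [mul_comm (Real.log _)]
    exact (integrableOn_polynomialEnsembleKernel_mul u
      (integrableOn_log_mul_weight hnt hH.system hδ)).1
  have hlog' : IntegrableOn (fun y => K u y * Real.log (1 + δ * y)) (Ioi 0) := by
    simpa only [mul_comm] using hlog
  -- The same mixture formula with f = log(1+g); the added harmonic constant is integrable against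
  -- K(u,·), whose total mass is 1.
  have hrate := hmix (f := fun g => Real.log (1 + g))
    (F := fun c => Real.log (1 + c) + (harmonic (nt - 1) : ℝ)) (by fun_prop)
    (fun g hg => Real.log_nonneg (by linarith))
    (fun c hc => (integral_sinrMixingKernel_mul_log hnt hc).1)
    (fun c hc => (integral_sinrMixingKernel_mul_log hnt hc).2)
    (by
      simp_rw [mul_add]
      exact hlog'.add (hw.1.mul_const _))
  have hlogm : Measurable fun g : ℝ => Real.log (1 + g) := by fun_prop
  have hρm : AEMeasurable (fun g => ENNReal.ofReal (ρ g)) (volume.restrict (Ioi (0 : ℝ))) :=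
    hρi.aemeasurable.ennreal_ofReal
  have hae : ∀ k : Fin nt, (fun g => Real.log (1 + g) * ρ g) =ᵐ[volume.restrict (Ioi (0 : ℝ))]
      fun g => (ENNReal.ofReal (ρ g)).toReal • Real.log (1 + g) := by
    intro k
    filter_upwards [(hlaw k).1] with g hg
    rw [ENNReal.toReal_ofReal hg, smul_eq_mul, mul_comm]
  have hint : ∀ k : Fin nt, Integrable (fun ω => Real.log (1 + mmseSINR δ (H ω) k)) P := by
    intro k
    have h1 : Integrable (fun g : ℝ => Real.log (1 + g))
        (P.map fun ω => mmseSINR δ (H ω) k) := by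
      rw [(hlaw k).2, integrable_withDensity_iff_integrable_smul₀' hρm
        (ae_of_all _ fun _ => ENNReal.ofReal_lt_top)]
      exact hrate.1.congr (hae k)
    exact (integrable_map_measure hlogm.aestronglyMeasurable (hmeas k)).1 h1
  have hval : ∀ k : Fin nt, ∫ ω, Real.log (1 + mmseSINR δ (H ω) k) ∂P =
      (∫ x in Ioi (0 : ℝ), Real.log (1 + δ * x) * K u x) + harmonic (nt - 1) := by
    intro k
    rw [← integral_map (hmeas k) hlogm.aestronglyMeasurable, (hlaw k).2,
      integral_withDensity_eq_integral_toReal_smul₀ hρm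
        (ae_of_all _ fun _ => ENNReal.ofReal_lt_top), ← integral_congr_ae (hae k), hrate.2]
    simp_rw [mul_add]
    rw [integral_add hlog' (hw.1.mul_const _), integral_mul_const, hw.2, one_mul]
    simp_rw [mul_comm (K u _)]
  refine ⟨fun g hg => intervalIntegrable_weighted_comp_mul nt (div_pos hg hδ) hw.1, hρi,
    (hlaw ⟨0, hn0⟩).1, fun k => ⟨hmeas k, (hlaw k).2⟩, hint, hlog, ?_⟩
  rw [mmseSumRate]
  simp_rw [hval]
  rw [Finset.sum_const, Finset.card_univ, Fintype.card_fin, nsmul_eq_mul,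
    Real.logDeriv_Gamma_natCast hn0]
  ring
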